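/- Let $\lambda_1,\lambda_2,\mu_1,\mu_2>0$ and $\rho_i=\lambda_i/\mu_i$, and assume $\rho_1<1/2$ and $\rho_1+\rho_2<1$. For $x=(x_1,x_2)\in\mathbb{N}^2$ and $i\in\{1,2\}$ let \[ W_i(x)=\frac{\log(1+x_i)}{\log(1+x_1)+\log(1+x_2)},\qquad \tfrac00:=0 . \] For each $N\in\mathbb{N}$ let $(L^N_1(t),L^N_2(t))_{t\ge 0}$ be a càdlàg $\mathbb{N}^2$-valued solution, on some filtered probability space, of the stochastic differential equation \[ \mathrm{d}L_i(t)=\mathcal N_{\lambda_i}(\mathrm{d}t)-\mathcal N_{\mu_iW_i(L_1(t-),L_2(t-))}(\mathrm{d}t),\qquad i=1,2, \] where $\mathcal N_{h}(\mathrm{d}u)=\mathcal P([0,h(u)]\times \mathrm{d}u)$ for a Poisson point process $\mathcal P$ on $\mathbb{R}_+^2$ with rate $1$, and the four Poisson point processes used (one for the arrivals and one for the departures of each class) are independent; the solution is adapted to the filtration, and the restriction of the four Poisson point processes to times after $t$ is independent of the filtration at time $t$. Put \[ \alpha^*=\frac{\rho_1}{1-\rho_1},\qquad t_0=\frac{1}{\mu_2(1-\rho_1-\rho_2)},\qquad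 \gamma(t)=1+\mu_2(\rho_1+\rho_2-1)t . \] Suppose that $L^N_2(0)=N$ almost surely for every $N$, and that $L^N_1(0)/N^{\alpha^*}\to 1$ in probability as $N\to\infty$ (for instance, $L_1^N(0)$ is deterministic and $L^N_1(0)/N^{\alpha^*}\to1$). Then, as $N\to\infty$, the processes \[ \left(\left(\frac{L^N_1(Nt)}{N^{\alpha^*}},\frac{L^N_2(Nt)}{N}\right),\ 0\le t<t_0\right) \] converge in distribution to the deterministic process $\big((\gamma(t)^{\alpha^*},\gamma(t)),\ 0\le t<t_0\big)$, in the space of càdlàg functions from $[0,t_0)$ to $\mathbb{R}^2$ with the topology of uniform convergence on compact subsets of $[0,t_0)$ and the $\sigma$-algebra generated by the evaluations; that is, the expectation of every bounded functional that is continuous and measurable for these structures converges to its value at the limit. -/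

import Mathlib

open MeasureTheory ProbabilityTheory Filter Set
open scoped NNReal ENNReal Topology

namespace LogSharing

noncomputable section

/-! ### Poisson point processes -/

/-- The random set `S` is (the set of points of) a Poisson point process with intensity `ν`. -/
structure IsPoissonPointProcess {Ω E : Type*} [MeasurableSpace Ω] [MeasurableSpace E]
    (S : Ω → Set E) (ν : Measure E) (P : Measure Ω) : Prop where
  /-- the number of points in a measurable set is a random variable -/
  measurable_count : ∀ B : Set E, MeasurableSet B → Measurable fun ω => (S ω ∩ B).encard
  /-- the number of points in a set of finite intensity is a Poisson variable -/
  law : ∀ B : Set E, MeasurableSet B → ν B ≠ ∞ →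
    P.map (fun ω => (S ω ∩ B).encard) =
      (poissonMeasure (ν B).toNNReal).map (fun k : ℕ => (k : ℕ∞))
  /-- the numbers of points in disjoint sets are independent -/
  indep : ∀ (n : ℕ) (B : Fin n → Set E), (∀ i, MeasurableSet (B i)) →
    (∀ i j, i ≠ j → Disjoint (B i) (B j)) →
    iIndepFun (fun i ω => (S ω ∩ B i).encard) P

/-- The σ-algebra generated by the points of `S` whose time (second coordinate) lies in `I`. -/
@[reducible] def pointSigma {Ω : Type*} (S : Ω → Set (ℝ≥0 × ℝ≥0)) (I : Set ℝ≥0) : MeasurableSpace Ω :=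
  ⨆ B ∈ {B : Set (ℝ≥0 × ℝ≥0) | MeasurableSet B ∧ ∀ p ∈ B, p.2 ∈ I},
    MeasurableSpace.comap (fun ω => (S ω ∩ B).encard) inferInstance

/-- Lebesgue measure on the quadrant `ℝ₊ × ℝ₊`. -/
def quadrantVolume : Measure (ℝ≥0 × ℝ≥0) :=
  Measure.comap (fun p => ((p.1 : ℝ), (p.2 : ℝ))) (volume : Measure (ℝ × ℝ))

/-- Four independent Poisson point processes on `ℝ₊ × ℝ₊` (mark, time) with rate `1`, relative to
the filtration `F` (adapted to it, and after each time `t` independent of `F t`): `pts (.inl i)` drives the arrivals at queue `i` and `pts (.inr i)` drives its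
departures. -/
structure IsDrivingNoise {Ω : Type*} [m : MeasurableSpace Ω] (F : Filtration ℝ≥0 m)
    (pts : Fin 2 ⊕ Fin 2 → Ω → Set (ℝ≥0 × ℝ≥0)) (P : Measure Ω) : Prop where
  poisson : ∀ j, IsPoissonPointProcess (pts j) quadrantVolume P
  indep : iIndep (fun j => pointSigma (pts j) univ) P
  adapted : ∀ j t, pointSigma (pts j) (Iic t) ≤ F t
  indep_future : ∀ t, Indep (⨆ j, pointSigma (pts j) (Ioi t)) (F t) P

/-- `𝒩_h((0,t])`: the number of points `(z, u)` of `S` with `0 < u ≤ t` and `z ≤ h u`. -/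
def thinnedCount (S : Set (ℝ≥0 × ℝ≥0)) (h : ℝ≥0 → ℝ) (t : ℝ≥0) : ℕ∞ :=
  (S ∩ {p | 0 < p.2 ∧ p.2 ≤ t ∧ (p.1 : ℝ) ≤ h p.2}).encard

/-! ### The two queues. Class 1 has index `0` and class 2 has index `1`. -/

/-- The fraction of the capacity that queue `i` receives in state `x` (with `0 / 0 = 0`). -/
def share (i : Fin 2) (x : Fin 2 → ℕ) : ℝ :=
  Real.log (1 + x i) / (Real.log (1 + x 0) + Real.log (1 + x 1))

/-- The load `ρ_i = λ_i / μ_i`. -/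
def load (lam mu : Fin 2 → ℝ) (i : Fin 2) : ℝ := lam i / mu i

/-- The exponent `α* = ρ_1 / (1 - ρ_1)`. -/
def alphaStar (lam mu : Fin 2 → ℝ) : ℝ := load lam mu 0 / (1 - load lam mu 0)

/-- Right-continuous with left limits. -/
def IsCadlag {T E : Type*} [TopologicalSpace T] [LinearOrder T] [TopologicalSpace E]
    (f : T → E) : Prop :=
  ∀ t, ContinuousWithinAt f (Ici t) t ∧ ∃ l, Tendsto f (𝓝[<] t) (𝓝 l)

/-- `L` is a solution of
`dL_i(t) = 𝒩_{λ_i}(dt) - 𝒩_{μ_i W_i(L(t-))}(dt)`, `i = 1, 2`, driven by `pts`. -/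
structure IsSolution {Ω : Type*} [m : MeasurableSpace Ω] (lam mu : Fin 2 → ℝ)
    (F : Filtration ℝ≥0 m) (pts : Fin 2 ⊕ Fin 2 → Ω → Set (ℝ≥0 × ℝ≥0)) (P : Measure Ω)
    (L : ℝ≥0 → Ω → Fin 2 → ℕ) : Prop where
  noise : IsDrivingNoise F pts P
  adapted : ∀ t, Measurable[F t] (L t)
  cadlag : ∀ ω, IsCadlag fun t => L t ω
  /-- the integrated equation, with the departures moved to the left-hand side -/
  equation : ∀ᵐ ω ∂P, ∀ (t : ℝ≥0) (i : Fin 2),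
    (L t ω i : ℕ∞) +
        thinnedCount (pts (.inr i) ω)
          (fun u => mu i * share i (Function.leftLim (fun s => L s ω) u)) t =
      (L 0 ω i : ℕ∞) + thinnedCount (pts (.inl i) ω) (fun _ => lam i) t

/-! ### Convergence in distribution of processes on `[0, a)` -/

/-- The space of càdlàg functions from `[0, a)` to `ℝ²`. -/
structure CadlagPath (a : ℝ) where
  toFun : Ico (0 : ℝ) a → ℝ × ℝ
  cadlag : IsCadlag toFun

/-- The topology of uniform convergence on the compact subsets of `[0, a)`. -/
instance (a : ℝ) : TopologicalSpace (CadlagPath a) :=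
  TopologicalSpace.induced
    (fun f => UniformOnFun.ofFun {K : Set (Ico (0 : ℝ) a) | IsCompact K} f.toFun) inferInstance

/-- The σ-algebra generated by the evaluations. -/
instance (a : ℝ) : MeasurableSpace (CadlagPath a) :=
  MeasurableSpace.comap CadlagPath.toFun MeasurableSpace.pi

/-- The random elements `X N` of `E` converge in distribution to the probability measure `ν`:
expectations of bounded continuous measurable functionals converge. -/
def ConvergesInDistribution {E : Type*} [TopologicalSpace E] [MeasurableSpace E]
    {Ω : ℕ → Type*} [∀ N, MeasurableSpace (Ω N)] (P : ∀ N, Measure (Ω N))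
    (X : ∀ N, Ω N → E) (ν : Measure E) : Prop :=
  (∀ N, Measurable (X N)) ∧
    ∀ Φ : E → ℝ, Continuous Φ → Measurable Φ → (∃ C, ∀ x, |Φ x| ≤ C) →
      Tendsto (fun N => ∫ ω, Φ (X N ω) ∂(P N)) atTop (𝓝 (∫ x, Φ x ∂ν))

theorem IsCadlag.comp_monotone {S T E : Type*} [TopologicalSpace S] [LinearOrder S]
    [OrderClosedTopology S] [TopologicalSpace T] [LinearOrder T] [TopologicalSpace E] {f : T → E}
    (hf : IsCadlag f) {g : S → T} (hg : Monotone g) (hc : Continuous g) :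
    IsCadlag (f ∘ g) := by
  intro t
  refine ⟨(hf (g t)).1.comp hc.continuousWithinAt (fun s hs => hg hs), ?_⟩
  by_cases h : ∃ s, s < t ∧ g s = g t
  · obtain ⟨s, hs, he⟩ := h
    refine ⟨f (g t), tendsto_const_nhds.congr' ?_⟩
    filter_upwards [self_mem_nhdsWithin, mem_nhdsWithin_of_mem_nhds (Ioi_mem_nhds hs)]
      with u hu hsu
    have : g u = g t := le_antisymm (hg (le_of_lt hu)) (he ▸ hg (le_of_lt hsu))
    simp [this]
  · obtain ⟨l, hl⟩ := (hf (g t)).2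
    refine ⟨l, hl.comp (tendsto_nhdsWithin_iff.2 ⟨hc.continuousWithinAt, ?_⟩)⟩
    filter_upwards [self_mem_nhdsWithin] with u hu
    exact lt_of_le_of_ne (hg (le_of_lt hu)) (fun e => h ⟨u, hu, e⟩)

theorem IsCadlag.continuous_comp {T E G : Type*} [TopologicalSpace T] [LinearOrder T]
    [TopologicalSpace E] [TopologicalSpace G] {f : T → E} (hf : IsCadlag f) {φ : E → G}
    (hφ : Continuous φ) : IsCadlag (φ ∘ f) := by
  intro t
  obtain ⟨l, hl⟩ := (hf t).2
  exact ⟨hφ.continuousAt.comp_continuousWithinAt (hf t).1, φ l, (hφ.tendsto l).comp hl⟩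

theorem isCadlag_of_continuous {T E : Type*} [TopologicalSpace T] [LinearOrder T]
    [TopologicalSpace E] {f : T → E} (hf : Continuous f) : IsCadlag f :=
  fun t => ⟨hf.continuousWithinAt, f t, hf.continuousWithinAt⟩

/-- The path `t ↦ (x_1(Nt) / N^α, x_2(Nt) / N)` on `[0, a)`. -/
def scaledPath (a α : ℝ) (N : ℕ) (x : ℝ≥0 → Fin 2 → ℕ) (hx : IsCadlag x) : CadlagPath a where
  toFun t := ((x (N * (t : ℝ)).toNNReal 0 : ℝ) / (N : ℝ) ^ α,
    (x (N * (t : ℝ)).toNNReal 1 : ℝ) / N)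
  cadlag := by
    have hg : Monotone fun t : Ico (0 : ℝ) a => ((N : ℝ) * (t : ℝ)).toNNReal := fun s t h =>
      Real.toNNReal_le_toNNReal (mul_le_mul_of_nonneg_left h (Nat.cast_nonneg N))
    have hc : Continuous fun t : Ico (0 : ℝ) a => ((N : ℝ) * (t : ℝ)).toNNReal := by fun_prop
    exact (hx.comp_monotone hg hc).continuous_comp
      (φ := fun y : Fin 2 → ℕ => ((y 0 : ℝ) / (N : ℝ) ^ α, (y 1 : ℝ) / N))
      continuous_of_discreteTopology

/-- The time `t_0 = 1 / (μ_2 (1 - ρ_1 - ρ_2))`. -/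
def tZero (lam mu : Fin 2 → ℝ) : ℝ := 1 / (mu 1 * (1 - load lam mu 0 - load lam mu 1))

/-- The function `γ(t) = 1 + μ_2 (ρ_1 + ρ_2 - 1) t`. -/
def gam (lam mu : Fin 2 → ℝ) (t : ℝ) : ℝ := 1 + mu 1 * (load lam mu 0 + load lam mu 1 - 1) * t

theorem gam_pos (lam mu : Fin 2 → ℝ) (t : Ico (0 : ℝ) (tZero lam mu)) :
    0 < gam lam mu t := by
  obtain ⟨t, h0, h1⟩ := t
  unfold tZero at h1
  set c := mu 1 * (1 - load lam mu 0 - load lam mu 1) with hc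
  have hcpos : 0 < c := one_div_pos.1 (lt_of_le_of_lt h0 h1)
  have : t * c < 1 := (lt_div_iff₀ hcpos).1 h1
  have e : gam lam mu t = 1 - t * c := by rw [hc]; unfold gam; ring
  simpa [e] using this

/-- The path `t ↦ (γ(t)^{α*}, γ(t))` on `[0, t_0)`. -/
def limitPath (lam mu : Fin 2 → ℝ) : CadlagPath (tZero lam mu) where
  toFun t := (gam lam mu t ^ alphaStar lam mu, gam lam mu t)
  cadlag := by
    have h : Continuous fun t : Ico (0 : ℝ) (tZero lam mu) => gam lam mu t := by
      unfold gam; fun_prop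
    exact isCadlag_of_continuous
      ((h.rpow_const fun t => Or.inl (gam_pos lam mu t).ne').prodMk h)

end

end LogSharing

namespace LogSharing

noncomputable section

/-! ### Exponential bounds for Poisson variables -/

/-! Put `ρ = ρ₁`, `α = α*`, so that `ρ = α (1 - ρ)`, and `c = μ₂ (1 - ρ₁ - ρ₂)`. If `log L₁ ≈ α log
L₂`, class 1 gets the share `α / (1 + α) = ρ` and is balanced, while class 2 gets `1 - ρ` and drains
along the fluid line `N - c s`. To see that this regime is stable, let `X` and `Y` be the deviations
of `log (1 + L₁)` and `log (1 + L₂)` from `α log (N - c s)` and `log (N - c s)`. The exact identity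
`share_fst_sub` reads `W₁ - ρ = (1 - ρ) (X - α Y) / (total log weight)`, and the weight has order
`log N`. Two consequences carry the proof. As long as `X` and `Y` are merely bounded, `W₂ = 1 - ρ +
O(1 / log N)`, so `L₂` follows its line to within a small multiple of `N`. Once `X` leaves a band of
width of order `ε` while `Y` is much smaller, `L₁` feels a restoring drift of order `1 / log N`.
This beats the speed of the target `(N - c s)^α`, of order `N^(α - 1)`, because `ρ₁ < 1/2` means `α
< 1`. The argument is pathwise. While a share stays on one side of a constant, departures compare
with the Poisson points below a deterministic level (`sub_le_of_le_share`, `le_sub_of_share_le`), so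
no stochastic calculus is needed. A Chernoff bound with parameter of order `1 / log N` and a union
bound over integer intervals keep all these counts within order `N^α` of their drifts, outside an
event of probability `O(N² exp(-q N^α / log N))` for some `q > 0`. On the good event a deterministic
induction (`abs_logDev_natCast_le`) traps the path. The limit being deterministic, uniform closeness
in probability on each `[0, T]` gives convergence in distribution (`convergesInDistribution_dirac`).
-/

theorem lintegral_exp_poissonMeasure (r : ℝ≥0) (θ : ℝ) :
    ∫⁻ n, ENNReal.ofReal (Real.exp (θ * (n : ℝ))) ∂poissonMeasure r =
      ENNReal.ofReal (Real.exp (r * (Real.exp θ - 1))) := by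
  have hs : HasSum (fun n : ℕ => Real.exp (-r) * ((r * Real.exp θ) ^ n / (n.factorial : ℝ)))
      (Real.exp (r * (Real.exp θ - 1))) := by
    have h := (NormedSpace.expSeries_div_hasSum_exp ((r : ℝ) * Real.exp θ)).mul_left
      (Real.exp (-r))
    rw [← Real.exp_eq_exp_ℝ, ← Real.exp_add] at h
    convert! h using 2
    ring
  rw [poissonMeasure, lintegral_sum_measure]
  simp only [lintegral_smul_measure, lintegral_dirac, smul_eq_mul]
  rw [← hs.tsum_eq, ENNReal.ofReal_tsum_of_nonneg (fun n => by positivity) hs.summable]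
  refine tsum_congr fun n => ?_
  rw [← ENNReal.ofReal_mul (by positivity)]
  congr 1
  rw [mul_pow, ← Real.exp_nat_mul, mul_comm (n : ℝ) θ]
  ring

theorem lintegral_exp_of_map_eq_poissonMeasure {Ω : Type*} [MeasurableSpace Ω] {P : Measure Ω}
    {X : Ω → ℕ∞} (hX : Measurable X) {r : ℝ≥0}
    (h : P.map X = (poissonMeasure r).map (fun k : ℕ => (k : ℕ∞))) (θ : ℝ) :
    ∫⁻ ω, ENNReal.ofReal (Real.exp (θ * ((X ω).toNat : ℝ))) ∂P =
      ENNReal.ofReal (Real.exp (r * (Real.exp θ - 1))) := by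
  have hm : Measurable fun n : ℕ∞ => ENNReal.ofReal (Real.exp (θ * (n.toNat : ℝ))) :=
    measurable_from_top
  rw [← lintegral_map (μ := P) hm hX, h, lintegral_map hm .of_discrete]
  simpa using lintegral_exp_poissonMeasure r θ

theorem exp_sub_one_le {θ : ℝ} (h : |θ| ≤ 1) : Real.exp θ - 1 ≤ θ + θ ^ 2 := by
  have := (abs_le.1 (Real.abs_exp_sub_one_sub_id_le h)).2
  linarith

/-- Chernoff bound for the difference of two independent Poisson variables. -/
theorem measure_poisson_sub_gt_le {Ω : Type*} [MeasurableSpace Ω] {P : Measure Ω}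
    [IsProbabilityMeasure P] {X Y : Ω → ℕ∞} (hX : Measurable X) (hY : Measurable Y)
    (hXY : IndepFun X Y P) {r s : ℝ≥0}
    (hr : P.map X = (poissonMeasure r).map (fun k : ℕ => (k : ℕ∞)))
    (hs : P.map Y = (poissonMeasure s).map (fun k : ℕ => (k : ℕ∞)))
    {θ d m : ℝ} (h0 : 0 ≤ θ) (h1 : θ ≤ 1) (hd : θ * (r + s) ≤ d) :
    P {ω | (r : ℝ) - s + d + m < ((X ω).toNat : ℝ) - ((Y ω).toNat : ℝ)} ≤
      ENNReal.ofReal (Real.exp (-(θ * m))) := by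
  set c : ℝ := r - s + d + m with hc
  set f : Ω → ℝ≥0∞ := fun ω => ENNReal.ofReal (Real.exp (θ * ((X ω).toNat : ℝ))) with hf
  set g : Ω → ℝ≥0∞ := fun ω => ENNReal.ofReal (Real.exp (-θ * ((Y ω).toNat : ℝ))) with hg
  have hm : ∀ θ : ℝ, Measurable fun n : ℕ∞ => ENNReal.ofReal (Real.exp (θ * (n.toNat : ℝ))) :=
    fun _ => measurable_from_top
  have hfm : Measurable f := (hm θ).comp hX
  have hgm : Measurable g := (hm (-θ)).comp hY
  have hfg : IndepFun f g P := hXY.comp (hm θ) (hm (-θ))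
  have h_int : ∫⁻ ω, (f * g) ω ∂P =
      ENNReal.ofReal (Real.exp (r * (Real.exp θ - 1)) * Real.exp (s * (Real.exp (-θ) - 1))) := by
    rw [lintegral_mul_eq_lintegral_mul_lintegral_of_indepFun hfm hgm hfg,
      lintegral_exp_of_map_eq_poissonMeasure hX hr, lintegral_exp_of_map_eq_poissonMeasure hY hs,
      ENNReal.ofReal_mul (by positivity)]
  have hmark := mul_meas_ge_le_lintegral (μ := P) (hfm.mul hgm) (ENNReal.ofReal (Real.exp (θ * c)))
  have hsub : {ω | c < ((X ω).toNat : ℝ) - ((Y ω).toNat : ℝ)} ⊆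
      {ω | ENNReal.ofReal (Real.exp (θ * c)) ≤ (f * g) ω} := by
    intro ω hω
    simp only [mem_ofPred_eq, Pi.mul_apply, hf, hg] at hω ⊢
    rw [← ENNReal.ofReal_mul (by positivity), ← Real.exp_add]
    refine ENNReal.ofReal_le_ofReal (Real.exp_le_exp.2 ?_)
    have := mul_le_mul_of_nonneg_left hω.le h0
    linarith
  -- The second-order cost `θ² (r + s)` is paid by the slack `θ d`; this is the role of `hd`.
  have hkey : (r : ℝ) * (Real.exp θ - 1) + s * (Real.exp (-θ) - 1) ≤ θ * (r - s + d) := by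
    have e1 := exp_sub_one_le (θ := θ) (by rwa [abs_of_nonneg h0])
    have e2 := exp_sub_one_le (θ := -θ) (by rwa [abs_neg, abs_of_nonneg h0])
    have e3 := mul_le_mul_of_nonneg_left e1 r.coe_nonneg
    have e4 := mul_le_mul_of_nonneg_left e2 s.coe_nonneg
    have e5 := mul_le_mul_of_nonneg_left hd h0
    nlinarith
  calc P {ω | c < ((X ω).toNat : ℝ) - ((Y ω).toNat : ℝ)}
      ≤ P {ω | ENNReal.ofReal (Real.exp (θ * c)) ≤ (f * g) ω} := measure_mono hsub
    _ = ENNReal.ofReal (Real.exp (-(θ * c))) * (ENNReal.ofReal (Real.exp (θ * c)) *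
          P {ω | ENNReal.ofReal (Real.exp (θ * c)) ≤ (f * g) ω}) := by
        rw [← mul_assoc, ← ENNReal.ofReal_mul (by positivity), ← Real.exp_add]
        simp
    _ ≤ ENNReal.ofReal (Real.exp (-(θ * c))) * ENNReal.ofReal
          (Real.exp (r * (Real.exp θ - 1)) * Real.exp (s * (Real.exp (-θ) - 1))) := by
        gcongr
        exact hmark.trans_eq h_int
    _ ≤ ENNReal.ofReal (Real.exp (-(θ * m))) := by
        rw [← ENNReal.ofReal_mul (by positivity), ← Real.exp_add, ← Real.exp_add]
        refine ENNReal.ofReal_le_ofReal (Real.exp_le_exp.2 ?_)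
        rw [hc]
        linarith

/-! ### Counting points below a level -/

/-- The points (mark, time) with time in `(s, t]` and mark at most `h` of the time. -/
def slab (h : ℝ≥0 → ℝ) (s t : ℝ≥0) : Set (ℝ≥0 × ℝ≥0) :=
  {p | s < p.2 ∧ p.2 ≤ t ∧ (p.1 : ℝ) ≤ h p.2}

theorem measurableSet_slab_const (a : ℝ) (s t : ℝ≥0) : MeasurableSet (slab (fun _ => a) s t) := by
  have h1 : MeasurableSet {p : ℝ≥0 × ℝ≥0 | s < p.2} := measurableSet_lt (by fun_prop) (by fun_prop)
  have h2 : MeasurableSet {p : ℝ≥0 × ℝ≥0 | p.2 ≤ t} := measurableSet_le (by fun_prop) (by fun_prop)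
  have h3 : MeasurableSet {p : ℝ≥0 × ℝ≥0 | (p.1 : ℝ) ≤ a} :=
    measurableSet_le (by fun_prop) (by fun_prop)
  exact h1.inter (h2.inter h3)

/-- Marks are nonnegative, so a negative level selects no points; hence `max a 0`. For `t < s` the
slab is empty and `ENNReal.ofReal` truncates to zero. -/
theorem quadrantVolume_slab_const (a : ℝ) (s t : ℝ≥0) :
    quadrantVolume (slab (fun _ => a) s t) = ENNReal.ofReal (max a 0 * ((t : ℝ) - s)) := by
  have he : MeasurableEmbedding fun p : ℝ≥0 × ℝ≥0 => ((p.1 : ℝ), (p.2 : ℝ)) :=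
    (MeasurableEmbedding.subtype_coe measurableSet_Ici).prodMap
      (MeasurableEmbedding.subtype_coe measurableSet_Ici)
  have himg : (fun p : ℝ≥0 × ℝ≥0 => ((p.1 : ℝ), (p.2 : ℝ))) '' slab (fun _ => a) s t =
      Icc 0 a ×ˢ Ioc (s : ℝ) t := by
    ext ⟨z, u⟩
    constructor
    · rintro ⟨p, ⟨h1, h2, h3⟩, he⟩
      simp only [Prod.mk.injEq] at he
      rw [← he.1, ← he.2]
      exact ⟨⟨p.1.coe_nonneg, h3⟩, by exact_mod_cast h1, by exact_mod_cast h2⟩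
    · rintro ⟨⟨h1, h2⟩, h3, h4⟩
      have hu : 0 ≤ u := s.coe_nonneg.trans h3.le
      exact ⟨(⟨z, h1⟩, ⟨u, hu⟩), ⟨h3, h4, h2⟩, rfl⟩
  rw [quadrantVolume, he.comap_apply, himg, Measure.volume_eq_prod, Measure.prod_prod,
    Real.volume_Icc, Real.volume_Ioc, ENNReal.ofReal_mul (le_max_right _ _)]
  congr 1
  rw [sub_zero]
  rcases le_total a 0 with h | h <;> simp [h, ENNReal.ofReal_of_nonpos]

theorem ae_ne_top_of_map_eq_poissonMeasure {Ω : Type*} [MeasurableSpace Ω] {P : Measure Ω}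
    {X : Ω → ℕ∞} (hX : Measurable X) {r : ℝ≥0}
    (h : P.map X = (poissonMeasure r).map (fun k : ℕ => (k : ℕ∞))) : ∀ᵐ ω ∂P, X ω ≠ ⊤ := by
  have : P.map X {⊤} = 0 := by
    rw [h, Measure.map_apply .of_discrete (measurableSet_singleton _)]
    have he : (fun k : ℕ => (k : ℕ∞)) ⁻¹' {⊤} = ∅ := by ext k; simp
    rw [he, measure_empty]
  rw [Measure.map_apply hX (measurableSet_singleton _)] at this
  rw [ae_iff]
  convert! this using 2
  ext ω
  simp

section Noise

variable {Ω : Type*} [m : MeasurableSpace Ω] {F : Filtration ℝ≥0 m}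
  {pts : Fin 2 ⊕ Fin 2 → Ω → Set (ℝ≥0 × ℝ≥0)} {P : Measure Ω}

theorem IsDrivingNoise.map_encard_slab (hn : IsDrivingNoise F pts P) (q : Fin 2 ⊕ Fin 2) (a : ℝ)
    (s t : ℝ≥0) :
    P.map (fun ω => (pts q ω ∩ slab (fun _ => a) s t).encard) =
      (poissonMeasure (max a 0 * ((t : ℝ) - s)).toNNReal).map (fun k : ℕ => (k : ℕ∞)) := by
  rw [(hn.poisson q).law _ (measurableSet_slab_const a s t)
    (by rw [quadrantVolume_slab_const]; exact ENNReal.ofReal_ne_top), quadrantVolume_slab_const]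
  rfl

theorem IsDrivingNoise.ae_finite (hn : IsDrivingNoise F pts P) :
    ∀ᵐ ω ∂P, ∀ (q : Fin 2 ⊕ Fin 2) (a t : ℕ), (pts q ω ∩ slab (fun _ => (a : ℝ)) 0 t).Finite := by
  simp only [ae_all_iff]
  intro q a t
  filter_upwards [ae_ne_top_of_map_eq_poissonMeasure
    ((hn.poisson q).measurable_count _ (measurableSet_slab_const a 0 t))
    (hn.map_encard_slab q a 0 t)] with ω hω
  exact encard_ne_top_iff.1 hω

theorem IsDrivingNoise.indepFun_encard (hn : IsDrivingNoise F pts P) {q q' : Fin 2 ⊕ Fin 2}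
    (hq : q ≠ q') {B B' : Set (ℝ≥0 × ℝ≥0)} (hB : MeasurableSet B) (hB' : MeasurableSet B') :
    IndepFun (fun ω => (pts q ω ∩ B).encard) (fun ω => (pts q' ω ∩ B').encard) P := by
  have h := hn.indep.indep hq
  have hle : ∀ (q : Fin 2 ⊕ Fin 2) {B : Set (ℝ≥0 × ℝ≥0)}, MeasurableSet B →
      MeasurableSpace.comap (fun ω => (pts q ω ∩ B).encard) inferInstance ≤
        pointSigma (pts q) univ := fun q B hB =>
    le_iSup₂_of_le B ⟨hB, fun _ _ => mem_univ _⟩ le_rfl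
  rw [IndepFun_iff_Indep]
  exact indep_of_indep_of_le_left (indep_of_indep_of_le_right h (hle q' hB')) (hle q hB)

/-- Deviation bound for the difference of two independent counts on one time interval. -/
theorem IsDrivingNoise.measure_ncard_sub_gt_le [IsProbabilityMeasure P]
    (hn : IsDrivingNoise F pts P) {q q' : Fin 2 ⊕ Fin 2} (hq : q ≠ q') {a b e θ : ℝ}
    (h0 : 0 ≤ θ) (h1 : θ ≤ 1) (he : θ * (max a 0 + max b 0) ≤ e) (m : ℝ) {s t : ℝ≥0}
    (hst : s ≤ t) :
    P {ω | (max a 0 - max b 0 + e) * ((t : ℝ) - s) + m <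
        ((pts q ω ∩ slab (fun _ => a) s t).ncard : ℝ) -
          (pts q' ω ∩ slab (fun _ => b) s t).ncard} ≤
      ENNReal.ofReal (Real.exp (-(θ * m))) := by
  have hts : 0 ≤ (t : ℝ) - s := sub_nonneg.2 (by exact_mod_cast hst)
  have ha := measurableSet_slab_const a s t
  have hb := measurableSet_slab_const b s t
  have key := measure_poisson_sub_gt_le ((hn.poisson q).measurable_count _ ha)
    ((hn.poisson q').measurable_count _ hb) (hn.indepFun_encard hq ha hb)
    (hn.map_encard_slab q a s t) (hn.map_encard_slab q' b s t) (d := e * ((t : ℝ) - s)) (m := m)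
    h0 h1 ?_
  · rw [Real.coe_toNNReal _ (mul_nonneg (le_max_right _ _) hts),
      Real.coe_toNNReal _ (mul_nonneg (le_max_right _ _) hts)] at key
    convert! key using 5
    ring
  · rw [Real.coe_toNNReal _ (mul_nonneg (le_max_right _ _) hts),
      Real.coe_toNNReal _ (mul_nonneg (le_max_right _ _) hts), ← add_mul, ← mul_assoc]
    exact mul_le_mul_of_nonneg_right he hts

/-- On every interval between integers up to `K`, the points of `S` below level `a` outnumber
those of `S'` below level `b` by at most the mean plus `e` times the length plus `m`. -/
def ExcessBounded (S S' : Set (ℝ≥0 × ℝ≥0)) (a b e m : ℝ) (K : ℕ) : Prop :=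
  ∀ j k : ℕ, j ≤ k → k ≤ K →
    ((S ∩ slab (fun _ => a) j k).ncard : ℝ) - (S' ∩ slab (fun _ => b) j k).ncard ≤
      (max a 0 - max b 0 + e) * ((k : ℝ) - j) + m

theorem IsDrivingNoise.measure_not_excessBounded_le [IsProbabilityMeasure P]
    (hn : IsDrivingNoise F pts P) {q q' : Fin 2 ⊕ Fin 2} (hq : q ≠ q') {a b e θ : ℝ}
    (h0 : 0 ≤ θ) (h1 : θ ≤ 1) (he : θ * (max a 0 + max b 0) ≤ e) (m : ℝ) (K : ℕ) :
    P {ω | ¬ ExcessBounded (pts q ω) (pts q' ω) a b e m K} ≤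
      ENNReal.ofReal (((K : ℝ) + 1) ^ 2 * Real.exp (-(θ * m))) := by
  -- Union bound over the `(K + 1)²` pairs of endpoints; wrongly ordered pairs contribute the empty
  -- set.
  set B : ℕ × ℕ → Set Ω := fun p => {ω | p.1 ≤ p.2 ∧
    (max a 0 - max b 0 + e) * ((p.2 : ℝ) - p.1) + m <
        ((pts q ω ∩ slab (fun _ => a) p.1 p.2).ncard : ℝ) -
          (pts q' ω ∩ slab (fun _ => b) p.1 p.2).ncard}
  have hsub : {ω | ¬ ExcessBounded (pts q ω) (pts q' ω) a b e m K} ⊆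
      ⋃ p ∈ Finset.range (K + 1) ×ˢ Finset.range (K + 1), B p := by
    intro ω hω
    simp only [ExcessBounded, mem_ofPred_eq, not_forall, not_le] at hω
    obtain ⟨j, k, hjk, hk, h⟩ := hω
    simp only [mem_iUnion]
    exact ⟨(j, k), by simp; omega, hjk, h⟩
  have hB : ∀ p, P (B p) ≤ ENNReal.ofReal (Real.exp (-(θ * m))) := by
    intro p
    by_cases hp : p.1 ≤ p.2
    · refine (measure_mono fun ω hω => ?_).trans
        (hn.measure_ncard_sub_gt_le hq h0 h1 he m (s := p.1) (t := p.2) (by exact_mod_cast hp))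
      simpa using hω.2
    · have : B p = ∅ := by ext ω; simp [B, hp]
      simp [this]
  calc _ ≤ P (⋃ p ∈ Finset.range (K + 1) ×ˢ Finset.range (K + 1), B p) := measure_mono hsub
    _ ≤ ∑ p ∈ Finset.range (K + 1) ×ˢ Finset.range (K + 1), P (B p) :=
        measure_biUnion_finset_le _ _
    _ ≤ ∑ p ∈ Finset.range (K + 1) ×ˢ Finset.range (K + 1),
          ENNReal.ofReal (Real.exp (-(θ * m))) := Finset.sum_le_sum fun p _ => hB p
    _ = _ := by
        rw [Finset.sum_const, Finset.card_product, Finset.card_range, nsmul_eq_mul,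
          ENNReal.ofReal_mul (by positivity)]
        congr 1
        rw [← ENNReal.ofReal_natCast]
        congr 1
        push_cast
        ring

end Noise

/-! ### Pathwise comparison with counts below constant levels -/

theorem log_one_add_natCast_nonneg (n : ℕ) : 0 ≤ Real.log (1 + (n : ℝ)) :=
  Real.log_nonneg (by simp)

theorem share_le_one (i : Fin 2) (x : Fin 2 → ℕ) : share i x ≤ 1 := by
  refine div_le_one_of_le₀ ?_
    (add_nonneg (log_one_add_natCast_nonneg _) (log_one_add_natCast_nonneg _))
  have h0 := log_one_add_natCast_nonneg (x 0)
  have h1 := log_one_add_natCast_nonneg (x 1)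
  fin_cases i
  · simpa using h1
  · simpa using h0

/-- In a discrete space a left limit is attained just before `u`. Bounds on the shares over `[s, t)`
therefore control the departure rates, which involve left limits, over `(s, t]`. -/
theorem IsCadlag.exists_leftLim_eq {E : Type*} [TopologicalSpace E] [DiscreteTopology E]
    {x : ℝ≥0 → E} (hx : IsCadlag x) {s u : ℝ≥0} (hsu : s < u) :
    ∃ v, s ≤ v ∧ v < u ∧ Function.leftLim x u = x v := by
  obtain ⟨l, hl⟩ := (hx u).2
  have hne : (𝓝[<] u).NeBot := nhdsLT_neBot_of_exists_lt ⟨s, hsu⟩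
  have hev : ∀ᶠ v in 𝓝[<] u, x v = l := by
    rw [nhds_discrete, tendsto_pure] at hl
    exact hl
  have hs : ∀ᶠ v in 𝓝[<] u, s < v := mem_nhdsWithin_of_mem_nhds (Ioi_mem_nhds hsu)
  have hu : ∀ᶠ v in 𝓝[<] u, v < u := self_mem_nhdsWithin
  obtain ⟨v, hv, hsv, hvu⟩ := (hev.and (hs.and hu)).exists
  exact ⟨v, le_of_lt hsv, hvu, by rw [leftLim_eq_of_tendsto hl, hv]⟩

theorem slab_zero_eq_union (h : ℝ≥0 → ℝ) {s t : ℝ≥0} (hst : s ≤ t) :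
    slab h 0 t = slab h 0 s ∪ slab h s t := by
  ext p
  simp only [slab, mem_ofPred_eq, mem_union]
  constructor
  · rintro ⟨h1, h2, h3⟩
    rcases le_or_gt p.2 s with h | h
    · exact Or.inl ⟨h1, h, h3⟩
    · exact Or.inr ⟨h, h2, h3⟩
  · rintro (⟨h1, h2, h3⟩ | ⟨h1, h2, h3⟩)
    · exact ⟨h1, h2.trans hst, h3⟩
    · exact ⟨lt_of_le_of_lt zero_le h1, h2, h3⟩

theorem disjoint_slab (h : ℝ≥0 → ℝ) (r s t : ℝ≥0) : Disjoint (slab h r s) (slab h s t) :=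
  Set.disjoint_left.2 fun _ h1 h2 => absurd h2.1 (not_lt.2 h1.2.1)

theorem slab_mono {h h' : ℝ≥0 → ℝ} {s s' t t' : ℝ≥0} (hs : s' ≤ s) (ht : t ≤ t')
    (hh : ∀ u, s < u → u ≤ t → h u ≤ h' u) : slab h s t ⊆ slab h' s' t' :=
  fun _ hp => ⟨lt_of_le_of_lt hs hp.1, hp.2.1.trans ht, hp.2.2.trans (hh _ hp.1 hp.2.1)⟩

/-- The path `x` solves the equation driven by the locally finite point sets `S`. -/
structure IsPathSolution (lam mu : Fin 2 → ℝ) (S : Fin 2 ⊕ Fin 2 → Set (ℝ≥0 × ℝ≥0))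
    (x : ℝ≥0 → Fin 2 → ℕ) : Prop where
  cadlag : IsCadlag x
  finite : ∀ (q : Fin 2 ⊕ Fin 2) (a t : ℕ), (S q ∩ slab (fun _ => (a : ℝ)) 0 t).Finite
  equation : ∀ (t : ℝ≥0) (i : Fin 2),
    (x t i : ℕ∞) + thinnedCount (S (.inr i)) (fun u => mu i * share i (Function.leftLim x u)) t =
      (x 0 i : ℕ∞) + thinnedCount (S (.inl i)) (fun _ => lam i) t

namespace IsPathSolution

variable {lam mu : Fin 2 → ℝ} {S : Fin 2 ⊕ Fin 2 → Set (ℝ≥0 × ℝ≥0)} {x : ℝ≥0 → Fin 2 → ℕ}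

theorem finite_slab (hx : IsPathSolution lam mu S x) (q : Fin 2 ⊕ Fin 2) {h : ℝ≥0 → ℝ} {a : ℝ}
    (ha : ∀ u, h u ≤ a) (s t : ℝ≥0) : (S q ∩ slab h s t).Finite := by
  obtain ⟨A, hA⟩ := exists_nat_ge a
  obtain ⟨T, hT⟩ := exists_nat_ge t
  exact (hx.finite q A T).subset
    (inter_subset_inter_right _ (slab_mono zero_le hT fun u _ _ => (ha u).trans hA))

theorem ncard_slab_zero (hx : IsPathSolution lam mu S x) (q : Fin 2 ⊕ Fin 2) {h : ℝ≥0 → ℝ} {a : ℝ}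
    (ha : ∀ u, h u ≤ a) {s t : ℝ≥0} (hst : s ≤ t) :
    (S q ∩ slab h 0 t).ncard = (S q ∩ slab h 0 s).ncard + (S q ∩ slab h s t).ncard := by
  rw [slab_zero_eq_union h hst, inter_union_distrib_left,
    ncard_union_eq ((disjoint_slab h 0 s t).mono inter_subset_right inter_subset_right)
      (hx.finite_slab q ha _ _) (hx.finite_slab q ha _ _)]

theorem departure_rate_le (hmu : ∀ i, 0 < mu i) (i : Fin 2) (y : Fin 2 → ℕ) :
    mu i * share i y ≤ mu i := by
  simpa using mul_le_mul_of_nonneg_left (share_le_one i y) (hmu i).le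

/-- Balance of arrivals and departures on `(s, t]`. -/
theorem balance (hx : IsPathSolution lam mu S x) (hmu : ∀ i, 0 < mu i) (i : Fin 2) {s t : ℝ≥0}
    (hst : s ≤ t) :
    (x t i : ℝ) - x s i = (S (.inl i) ∩ slab (fun _ => lam i) s t).ncard -
      (S (.inr i) ∩ slab (fun u => mu i * share i (Function.leftLim x u)) s t).ncard := by
  have hr : ∀ u, (fun u => mu i * share i (Function.leftLim x u)) u ≤ mu i :=
    fun u => departure_rate_le hmu i _
  have hl : ∀ u : ℝ≥0, (fun _ : ℝ≥0 => lam i) u ≤ lam i := fun _ => le_rfl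
  have heq : ∀ t, x t i +
      (S (.inr i) ∩ slab (fun u => mu i * share i (Function.leftLim x u)) 0 t).ncard =
        x 0 i + (S (.inl i) ∩ slab (fun _ => lam i) 0 t).ncard := by
    intro t
    have h := hx.equation t i
    change (x t i : ℕ∞) +
      (S (.inr i) ∩ slab (fun u => mu i * share i (Function.leftLim x u)) 0 t).encard =
        (x 0 i : ℕ∞) + (S (.inl i) ∩ slab (fun _ => lam i) 0 t).encard at h
    -- Cancellation in `ℕ∞` needs finite counts, available because both levels are bounded.
    rw [← (hx.finite_slab (.inr i) hr 0 t).cast_ncard_eq,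
      ← (hx.finite_slab (.inl i) hl 0 t).cast_ncard_eq] at h
    exact_mod_cast h
  have h1 := heq t
  have h2 := heq s
  rw [hx.ncard_slab_zero (.inr i) hr hst, hx.ncard_slab_zero (.inl i) hl hst] at h1
  have h1' := congrArg (Nat.cast : ℕ → ℝ) h1
  have h2' := congrArg (Nat.cast : ℕ → ℝ) h2
  push_cast at h1' h2'
  linarith

theorem exists_share_eq (hx : IsPathSolution lam mu S x) (i : Fin 2) {s u : ℝ≥0} (hsu : s < u) :
    ∃ v, s ≤ v ∧ v < u ∧ share i (Function.leftLim x u) = share i (x v) := by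
  obtain ⟨v, h1, h2, h3⟩ := hx.cadlag.exists_leftLim_eq hsu
  exact ⟨v, h1, h2, by rw [h3]⟩

/-- Every point below the constant level `mu i * w` is an actual departure. The path-dependent
thinning is thus replaced by a count whose law is Poisson. -/
theorem sub_le_of_le_share (hx : IsPathSolution lam mu S x) (hmu : ∀ i, 0 < mu i) (i : Fin 2)
    {s t : ℝ≥0} (hst : s ≤ t) {w : ℝ} (hw : ∀ v, s ≤ v → v < t → w ≤ share i (x v)) :
    (x t i : ℝ) - x s i ≤ (S (.inl i) ∩ slab (fun _ => lam i) s t).ncard -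
      (S (.inr i) ∩ slab (fun _ => mu i * w) s t).ncard := by
  rw [hx.balance hmu i hst]
  gcongr
  · exact hx.finite_slab (.inr i) (fun u => departure_rate_le hmu i _) s t
  · refine slab_mono le_rfl le_rfl fun u hu hut => ?_
    obtain ⟨v, h1, h2, h3⟩ := hx.exists_share_eq i hu
    rw [h3]
    exact mul_le_mul_of_nonneg_left (hw v h1 (h2.trans_le hut)) (hmu i).le

theorem le_sub_of_share_le (hx : IsPathSolution lam mu S x) (hmu : ∀ i, 0 < mu i) (i : Fin 2)
    {s t : ℝ≥0} (hst : s ≤ t) {w : ℝ} (hw : ∀ v, s ≤ v → v < t → share i (x v) ≤ w) :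
    (x s i : ℝ) - x t i ≤ (S (.inr i) ∩ slab (fun _ => mu i * w) s t).ncard -
      (S (.inl i) ∩ slab (fun _ => lam i) s t).ncard := by
  have hb := hx.balance hmu i hst
  have : ((S (.inr i) ∩ slab (fun u => mu i * share i (Function.leftLim x u)) s t).ncard : ℝ) ≤
      (S (.inr i) ∩ slab (fun _ => mu i * w) s t).ncard := by
    gcongr
    · exact hx.finite_slab (.inr i) (fun u => le_rfl) s t
    · refine slab_mono le_rfl le_rfl fun u hu hut => ?_
      obtain ⟨v, h1, h2, h3⟩ := hx.exists_share_eq i hu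
      rw [h3]
      exact mul_le_mul_of_nonneg_left (hw v h1 (h2.trans_le hut)) (hmu i).le
  linarith

/-- On an interval the path moves by at most the number of arrivals and potential departures. -/
theorem abs_sub_le (hx : IsPathSolution lam mu S x) (hmu : ∀ i, 0 < mu i) (i : Fin 2)
    {s t t' : ℝ≥0} (hst : s ≤ t) (ht : t ≤ t') :
    |(x t i : ℝ) - x s i| ≤ (S (.inl i) ∩ slab (fun _ => lam i) s t').ncard +
      (S (.inr i) ∩ slab (fun _ => mu i) s t').ncard := by
  have hb := hx.balance hmu i hst
  have h1 : ((S (.inl i) ∩ slab (fun _ => lam i) s t).ncard : ℝ) ≤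
      (S (.inl i) ∩ slab (fun _ => lam i) s t').ncard := by
    gcongr
    · exact hx.finite_slab (.inl i) (fun u => le_rfl) s t'
    · exact slab_mono le_rfl ht fun _ _ _ => le_rfl
  have h2 : ((S (.inr i) ∩ slab (fun u => mu i * share i (Function.leftLim x u)) s t).ncard : ℝ) ≤
      (S (.inr i) ∩ slab (fun _ => mu i) s t').ncard := by
    gcongr
    · exact hx.finite_slab (.inr i) (fun u => le_rfl) s t'
    · exact slab_mono le_rfl ht fun _ _ _ => departure_rate_le hmu i _
  rw [hb, abs_le]
  constructor <;> linarith [Nat.cast_nonneg (α := ℝ) (S (.inl i) ∩ slab (fun _ => lam i) s t).ncard,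
    Nat.cast_nonneg (α := ℝ)
      (S (.inr i) ∩ slab (fun u => mu i * share i (Function.leftLim x u)) s t).ncard]

end IsPathSolution

/-! ### Deterministic tracking of the fluid path -/

/-- The same relative error serves both sides, since `2 - exp (-z) ≤ exp z`. -/
theorem abs_log_sub_log_le {A B z : ℝ} (hA : 0 < A) (h : |B - A| ≤ (1 - Real.exp (-z)) * A) :
    |Real.log B - Real.log A| ≤ z := by
  obtain ⟨h1, h2⟩ := abs_le.1 h
  have hlow : Real.exp (-z) * A ≤ B := by linarith
  have hB : 0 < B := (by positivity : 0 < Real.exp (-z) * A).trans_le hlow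
  have hup : B ≤ Real.exp z * A := by
    have : 2 ≤ Real.exp z + Real.exp (-z) := by
      have := Real.add_one_le_exp z
      have := Real.add_one_le_exp (-z)
      linarith
    nlinarith
  have l1 := Real.log_le_log (by positivity) hlow
  have l2 := Real.log_le_log hB hup
  rw [Real.log_mul (Real.exp_pos _).ne' hA.ne', Real.log_exp] at l1 l2
  exact abs_le.2 ⟨by linarith, by linarith⟩

/-- Finds the start of the excursion out of the band `p` that is in progress just before time `k`.
-/
theorem exists_last_lt {p : ℕ → Prop} {k : ℕ} (hk : 0 < k) (h0 : p 0) :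
    ∃ j < k, p j ∧ ∀ i, j < i → i < k → ¬ p i := by
  classical
  refine ⟨Nat.findGreatest p (k - 1), ?_, Nat.findGreatest_spec (Nat.zero_le _) h0, ?_⟩
  · have := Nat.findGreatest_le (P := p) (k - 1)
    omega
  · intro i hi hik
    exact Nat.findGreatest_is_greatest hi (by omega)

/-- A bound of the concave increments of a power, for exponents at most `1`. -/
theorem rpow_sub_rpow_le {α r r' G : ℝ} (h1 : α < 1) (hG : 0 < G) (hr' : G ≤ r')
    (hr : r' ≤ r) : r ^ α - r' ^ α ≤ G ^ (α - 1) * (r - r') := by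
  have hr'0 : 0 < r' := hG.trans_le hr'
  have h2 : (r / r') ^ α ≤ r / r' :=
    (Real.rpow_le_rpow_of_exponent_le ((one_le_div hr'0).2 hr) h1.le).trans_eq (Real.rpow_one _)
  have h3 : r ^ α = r' ^ α * (r / r') ^ α := by
    rw [← Real.mul_rpow hr'0.le (div_nonneg (hr'0.le.trans hr) hr'0.le), mul_div_cancel₀ _ hr'0.ne']
  calc r ^ α - r' ^ α = r' ^ α * ((r / r') ^ α - 1) := by rw [h3]; ring
    _ ≤ r' ^ α * (r / r' - 1) := by gcongr
    _ = r' ^ (α - 1) * (r - r') := by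
        rw [Real.rpow_sub_one hr'0.ne']
        field_simp
    _ ≤ G ^ (α - 1) * (r - r') := by
        refine mul_le_mul_of_nonneg_right ?_ (sub_nonneg.2 hr)
        exact Real.rpow_le_rpow_of_nonpos hG hr' (by linarith)

/-- The fluid path of the second queue, started at `N`. -/
def fluid (N c : ℝ) (s : ℝ≥0) : ℝ := N - c * s

/-- Logarithmic deviation of the first queue from the power `α` of the fluid path. -/
def logDevFst (α N c : ℝ) (x : ℝ≥0 → Fin 2 → ℕ) (s : ℝ≥0) : ℝ :=
  Real.log (1 + x s 0) - α * Real.log (fluid N c s)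

/-- Logarithmic deviation of the second queue from the fluid path. -/
def logDevSnd (N c : ℝ) (x : ℝ≥0 → Fin 2 → ℕ) (s : ℝ≥0) : ℝ :=
  Real.log (1 + x s 1) - Real.log (fluid N c s)

/-- The relations between the constants, the scale `N` and the horizon `K` under which a path can
be tracked with precision `ε`. -/
structure IsTrackingScale (α ρ c g ε κ β Δ d m N : ℝ) (K : ℕ) : Prop where
  α_pos : 0 < α
  α_lt_one : α < 1
  ρ_lt_one : ρ < 1
  ρ_eq : α * (1 - ρ) = ρ
  c_pos : 0 < c
  g_pos : 0 < g
  ε_pos : 0 < ε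
  ε_le : ε ≤ 1 / 2
  N_pos : 0 < N
  horizon : g * N ≤ N - c * K
  log_large : 4 - 4 * Real.log g ≤ Real.log N
  log_large' : 4 / Real.log N ≤ κ
  gap_le : Δ ≤ (1 - ρ) * (ε / 8) / (3 * Real.log N)
  c_le : c ≤ (1 - Real.exp (-(ε / 32))) * (g * N)
  m_le : m ≤ (1 - Real.exp (-(ε / 32))) * (Real.exp (-1) * (g * N) ^ α)
  m_le' : m ≤ (1 - Real.exp (-(ε / 32))) * (Real.exp (-1) * (g * N))
  -- The restoring drift `d` must outrun the decrease of `exp z * fluid ^ α` for `z ≤ 1`.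
  slope_le : Real.exp 1 * (g * N) ^ (α - 1) * c ≤ d
  β_le : β * N + 1 ≤ (1 - Real.exp (-(ε / 16))) * (g * N)

/-- Bounds on a path `x` up to time `K` which force `x` to stay near the fluid path. -/
structure IsControlled (α ρ c g ε κ β Δ d m N : ℝ) (K : ℕ) (x : ℝ≥0 → Fin 2 → ℕ) : Prop extends
    IsTrackingScale α ρ c g ε κ β Δ d m N K where
  start_fst : |logDevFst α N c x 0| ≤ ε / 2
  start_snd : |logDevSnd N c x 0| ≤ ε / 16
  unit : ∀ (i : Fin 2) (n : ℕ), n < K → ∀ s : ℝ≥0, n ≤ s → s ≤ (n + 1 : ℕ) →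
    |(x s i : ℝ) - x n i| ≤ m
  up_fst : ∀ j k : ℕ, j ≤ k → k ≤ K →
    (∀ v : ℝ≥0, j ≤ v → v < k → ρ + Δ ≤ share 0 (x v)) →
      (x k 0 : ℝ) ≤ x j 0 + m - d * ((k : ℝ) - j)
  down_fst : ∀ j k : ℕ, j ≤ k → k ≤ K →
    (∀ v : ℝ≥0, j ≤ v → v < k → share 0 (x v) ≤ ρ - Δ) → (x j 0 : ℝ) - m ≤ x k 0
  up_snd : ∀ k : ℕ, k ≤ K → (∀ v : ℝ≥0, v < k → 1 - ρ - κ ≤ share 1 (x v)) →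
      (x k 1 : ℝ) ≤ N - c * k + β * N
  down_snd : ∀ k : ℕ, k ≤ K → (∀ v : ℝ≥0, v < k → share 1 (x v) ≤ 1 - ρ + κ) →
      N - c * k - β * N ≤ (x k 1 : ℝ)

namespace IsControlled

variable {α ρ c g ε κ β Δ d m N : ℝ} {K : ℕ} {x : ℝ≥0 → Fin 2 → ℕ}

theorem le_fluid (h : IsControlled α ρ c g ε κ β Δ d m N K x) {s : ℝ≥0} (hs : s ≤ K) :
    g * N ≤ fluid N c s := by
  have : (s : ℝ) ≤ K := by exact_mod_cast hs
  have := mul_le_mul_of_nonneg_left this h.c_pos.le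
  unfold fluid
  linarith [h.horizon]

theorem fluid_pos (h : IsControlled α ρ c g ε κ β Δ d m N K x) {s : ℝ≥0} (hs : s ≤ K) :
    0 < fluid N c s := (mul_pos h.g_pos h.N_pos).trans_le (h.le_fluid hs)

theorem fluid_le (h : IsControlled α ρ c g ε κ β Δ d m N K x) (s : ℝ≥0) : fluid N c s ≤ N := by
  have := mul_nonneg h.c_pos.le s.coe_nonneg
  unfold fluid
  linarith

theorem fluid_anti (h : IsControlled α ρ c g ε κ β Δ d m N K x) {s t : ℝ≥0} (hst : s ≤ t) :
    fluid N c t ≤ fluid N c s := by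
  have : (s : ℝ) ≤ t := by exact_mod_cast hst
  have := mul_le_mul_of_nonneg_left this h.c_pos.le
  unfold fluid
  linarith

theorem log_fluid_bounds (h : IsControlled α ρ c g ε κ β Δ d m N K x) {s : ℝ≥0} (hs : s ≤ K) :
    Real.log N + Real.log g ≤ Real.log (fluid N c s) ∧
      Real.log (fluid N c s) ≤ Real.log N := by
  constructor
  · rw [← Real.log_mul h.N_pos.ne' h.g_pos.ne', mul_comm]
    exact Real.log_le_log (mul_pos h.g_pos h.N_pos) (h.le_fluid hs)
  · exact Real.log_le_log (h.fluid_pos hs) (h.fluid_le s)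

theorem log_g_nonpos (h : IsControlled α ρ c g ε κ β Δ d m N K x) : Real.log g ≤ 0 := by
  have := h.log_fluid_bounds (s := 0) zero_le
  linarith [this.1, this.2]

theorem four_le_log (h : IsControlled α ρ c g ε κ β Δ d m N K x) : 4 ≤ Real.log N := by
  linarith [h.log_large, h.log_g_nonpos]

/-- The total logarithmic weight is comparable to `log N`. -/
theorem weight_bounds (h : IsControlled α ρ c g ε κ β Δ d m N K x) {s : ℝ≥0} (hs : s ≤ K)
    (hX : |logDevFst α N c x s| ≤ 1) (hY : |logDevSnd N c x s| ≤ 1) :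
    Real.log N / 2 ≤ Real.log (1 + x s 0) + Real.log (1 + x s 1) ∧
      Real.log (1 + x s 0) + Real.log (1 + x s 1) ≤ 3 * Real.log N := by
  obtain ⟨h1, h2⟩ := h.log_fluid_bounds hs
  have h4 := h.four_le_log
  have hl := h.log_large
  have ha := h.α_pos
  have ha1 := h.α_lt_one
  unfold logDevFst at hX
  unfold logDevSnd at hY
  obtain ⟨x1, x2⟩ := abs_le.1 hX
  obtain ⟨y1, y2⟩ := abs_le.1 hY
  have hpos : 0 ≤ Real.log (fluid N c s) := by linarith [h.log_g_nonpos]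
  have e1 : 0 ≤ α * Real.log (fluid N c s) := mul_nonneg ha.le hpos
  have e2 : α * Real.log (fluid N c s) ≤ Real.log (fluid N c s) := by nlinarith
  -- Below, the `α` term is dropped and `log N + log g - 2 ≥ log N / 2`; above, `(1 + α) log N + 2 ≤
  -- 3 log N`.
  constructor <;> linarith [h.log_g_nonpos]

/-- With `A`, `B` the two log weights, `A - ρ (A + B) = (1 - ρ) (A - α B)` because `ρ = α (1 - ρ)`,
and the fluid logarithms cancel in `A - α B`. This is the restoring force. -/
theorem share_fst_sub (h : IsControlled α ρ c g ε κ β Δ d m N K x) {s : ℝ≥0} (hs : s ≤ K)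
    (hX : |logDevFst α N c x s| ≤ 1) (hY : |logDevSnd N c x s| ≤ 1) :
    share 0 (x s) - ρ = (1 - ρ) * (logDevFst α N c x s - α * logDevSnd N c x s) /
      (Real.log (1 + x s 0) + Real.log (1 + x s 1)) := by
  have hw := (h.weight_bounds hs hX hY).1
  have h4 := h.four_le_log
  have hpos : 0 < Real.log (1 + x s 0) + Real.log (1 + x s 1) := by linarith
  unfold share logDevFst logDevSnd
  rw [eq_div_iff hpos.ne', sub_mul, div_mul_cancel₀ _ hpos.ne']
  linear_combination (Real.log (1 + x s 1)) * h.ρ_eq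

theorem share_fst_ge (h : IsControlled α ρ c g ε κ β Δ d m N K x) {s : ℝ≥0} (hs : s ≤ K)
    (hX : |logDevFst α N c x s| ≤ 1) (hY : |logDevSnd N c x s| ≤ 1)
    (hd : ε / 8 ≤ logDevFst α N c x s - α * logDevSnd N c x s) :
    ρ + Δ ≤ share 0 (x s) := by
  have hw := h.weight_bounds hs hX hY
  have h4 := h.four_le_log
  have hpos : 0 < Real.log (1 + x s 0) + Real.log (1 + x s 1) := by linarith
  have hρ : 0 ≤ 1 - ρ := sub_nonneg.2 h.ρ_lt_one.le
  have key : (1 - ρ) * (ε / 8) / (3 * Real.log N) ≤ share 0 (x s) - ρ := by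
    rw [h.share_fst_sub hs hX hY]
    have hε := h.ε_pos
    gcongr ?_ / ?_
    · exact mul_nonneg hρ (by linarith)
    · exact mul_le_mul_of_nonneg_left hd hρ
    · exact hw.2
  linarith [h.gap_le]

theorem share_fst_le (h : IsControlled α ρ c g ε κ β Δ d m N K x) {s : ℝ≥0} (hs : s ≤ K)
    (hX : |logDevFst α N c x s| ≤ 1) (hY : |logDevSnd N c x s| ≤ 1)
    (hd : logDevFst α N c x s - α * logDevSnd N c x s ≤ -(ε / 8)) :
    share 0 (x s) ≤ ρ - Δ := by
  have hw := h.weight_bounds hs hX hY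
  have h4 := h.four_le_log
  have hpos : 0 < Real.log (1 + x s 0) + Real.log (1 + x s 1) := by linarith
  have hρ : 0 ≤ 1 - ρ := sub_nonneg.2 h.ρ_lt_one.le
  have hd' : ε / 8 ≤ -(logDevFst α N c x s - α * logDevSnd N c x s) := by linarith
  have key : (1 - ρ) * (ε / 8) / (3 * Real.log N) ≤ -(share 0 (x s) - ρ) := by
    rw [h.share_fst_sub hs hX hY, ← neg_div, ← mul_neg]
    have hε := h.ε_pos
    gcongr ?_ / ?_
    · exact mul_nonneg hρ (by linarith)
    · exact mul_le_mul_of_nonneg_left hd' hρ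
    · exact hw.2
  linarith [h.gap_le]

/-- Bounded deviations suffice: a numerator at most `2` over a weight at least `log N / 2`. So the
second queue can be tracked before the first is known precisely. -/
theorem abs_share_snd_sub_le (h : IsControlled α ρ c g ε κ β Δ d m N K x) {s : ℝ≥0} (hs : s ≤ K)
    (hX : |logDevFst α N c x s| ≤ 1) (hY : |logDevSnd N c x s| ≤ 1) :
    |share 1 (x s) - (1 - ρ)| ≤ κ := by
  have hw := h.weight_bounds hs hX hY
  have h4 := h.four_le_log
  have hpos : 0 < Real.log (1 + x s 0) + Real.log (1 + x s 1) := by linarith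
  have hρ0 : 0 ≤ ρ := by
    rw [← h.ρ_eq]
    exact mul_nonneg h.α_pos.le (sub_nonneg.2 h.ρ_lt_one.le)
  have hsum : share 0 (x s) + share 1 (x s) = 1 := by
    unfold share
    rw [← add_div, div_self hpos.ne']
  have e : share 1 (x s) - (1 - ρ) = -(share 0 (x s) - ρ) := by linarith
  rw [e, abs_neg, h.share_fst_sub hs hX hY, abs_div, abs_of_pos hpos]
  refine le_trans ?_ h.log_large'
  have hnum : |(1 - ρ) * (logDevFst α N c x s - α * logDevSnd N c x s)| ≤ 2 := by
    rw [abs_mul, abs_of_nonneg (sub_nonneg.2 h.ρ_lt_one.le)]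
    have : |logDevFst α N c x s - α * logDevSnd N c x s| ≤ 2 := by
      refine (abs_sub _ _).trans ?_
      rw [abs_mul, abs_of_pos h.α_pos]
      nlinarith [h.α_lt_one, h.α_pos, abs_nonneg (logDevSnd N c x s)]
    nlinarith [abs_nonneg (logDevFst α N c x s - α * logDevSnd N c x s)]
  rw [div_le_div_iff₀ hpos (by linarith)]
  nlinarith [hw.1]

/-- The logarithmic deviations vary little over a unit of time. -/
theorem abs_logDev_sub_le (h : IsControlled α ρ c g ε κ β Δ d m N K x) {n : ℕ} (hn : n < K)
    {s : ℝ≥0} (h1 : n ≤ s) (h2 : s ≤ (n + 1 : ℕ)) (hX : |logDevFst α N c x n| ≤ 1)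
    (hY : |logDevSnd N c x n| ≤ 1) :
    |logDevFst α N c x s - logDevFst α N c x n| ≤ ε / 16 ∧
      |logDevSnd N c x s - logDevSnd N c x n| ≤ ε / 16 := by
  have hnK : (n : ℝ≥0) ≤ K := by exact_mod_cast hn.le
  have hsK : s ≤ K := h2.trans (by exact_mod_cast hn)
  have hz : 0 ≤ 1 - Real.exp (-(ε / 32)) := by
    have : Real.exp (-(ε / 32)) ≤ 1 := Real.exp_le_one_iff.2 (by linarith [h.ε_pos])
    linarith
  have hgN : 0 < g * N := mul_pos h.g_pos h.N_pos
  have hfl : |Real.log (fluid N c s) - Real.log (fluid N c n)| ≤ ε / 32 := by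
    refine abs_log_sub_log_le (h.fluid_pos hnK) ?_
    have e : fluid N c s - fluid N c n = -(c * ((s : ℝ) - n)) := by
      unfold fluid
      simp only [NNReal.coe_natCast]
      ring
    have l1 : (0 : ℝ) ≤ (s : ℝ) - n := sub_nonneg.2 (by exact_mod_cast h1)
    have l2 : (s : ℝ) - n ≤ 1 := by
      have : (s : ℝ) ≤ ((n + 1 : ℕ) : ℝ) := by exact_mod_cast h2
      push_cast at this
      linarith
    rw [e, abs_neg, abs_of_nonneg (mul_nonneg h.c_pos.le l1)]
    calc c * ((s : ℝ) - n) ≤ c := by nlinarith [h.c_pos]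
      _ ≤ (1 - Real.exp (-(ε / 32))) * (g * N) := h.c_le
      _ ≤ _ := mul_le_mul_of_nonneg_left (h.le_fluid hnK) hz
  -- `exp (-1) * G` is the least size that a log deviation of at most `1` allows; the queue and the
  -- fluid each spend `ε / 32`.
  have hx : ∀ (i : Fin 2) (G : ℝ), Real.exp (-1) * G ≤ 1 + x n i →
      m ≤ (1 - Real.exp (-(ε / 32))) * (Real.exp (-1) * G) →
      |Real.log (1 + x s i) - Real.log (1 + x n i)| ≤ ε / 32 := by
    intro i G hG hm
    refine abs_log_sub_log_le (by positivity) ?_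
    have e : (1 + (x s i : ℝ)) - (1 + x n i) = x s i - x n i := by ring
    rw [e]
    exact (h.unit i n hn s h1 h2).trans (hm.trans (mul_le_mul_of_nonneg_left hG hz))
  have hfst := hx 0 ((g * N) ^ α) ?_ h.m_le
  have hsnd := hx 1 (g * N) ?_ h.m_le'
  · obtain ⟨a1, a2⟩ := abs_le.1 hfst
    obtain ⟨b1, b2⟩ := abs_le.1 hsnd
    obtain ⟨f1, f2⟩ := abs_le.1 hfl
    have ha := h.α_pos
    have ha1 := h.α_lt_one
    have hf : |α * (Real.log (fluid N c s) - Real.log (fluid N c n))| ≤ ε / 32 := by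
      rw [abs_mul, abs_of_pos ha]
      nlinarith [abs_nonneg (Real.log (fluid N c s) - Real.log (fluid N c n))]
    obtain ⟨g1, g2⟩ := abs_le.1 hf
    unfold logDevFst logDevSnd
    constructor <;> rw [abs_le] <;> constructor <;> linarith
  · rw [← Real.log_le_log_iff (by positivity) (by positivity),
      Real.log_mul (Real.exp_pos _).ne' hgN.ne', Real.log_exp]
    have := Real.log_le_log hgN (h.le_fluid hnK)
    have := (abs_le.1 hY).1
    unfold logDevSnd at this
    linarith
  · rw [← Real.log_le_log_iff (by positivity) (by positivity),
      Real.log_mul (Real.exp_pos _).ne' (Real.rpow_pos_of_pos hgN _).ne', Real.log_exp,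
      Real.log_rpow hgN]
    have l1 := mul_le_mul_of_nonneg_left (Real.log_le_log hgN (h.le_fluid hnK)) h.α_pos.le
    have l2 := (abs_le.1 hX).1
    unfold logDevFst at l2
    linarith

theorem one_add_eq_exp_logDevFst (h : IsControlled α ρ c g ε κ β Δ d m N K x) {s : ℝ≥0}
    (hs : s ≤ K) :
    1 + (x s 0 : ℝ) = Real.exp (logDevFst α N c x s) * fluid N c s ^ α := by
  have hf := h.fluid_pos hs
  rw [Real.rpow_def_of_pos hf, ← Real.exp_add, logDevFst, mul_comm α, sub_add_cancel,
    Real.exp_log (by positivity)]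

theorem logDevFst_le_of_le (h : IsControlled α ρ c g ε κ β Δ d m N K x) {s : ℝ≥0}
    (hs : s ≤ K) {z : ℝ} (hz : 1 + (x s 0 : ℝ) ≤ Real.exp z * fluid N c s ^ α) :
    logDevFst α N c x s ≤ z := by
  rw [h.one_add_eq_exp_logDevFst hs] at hz
  exact Real.exp_le_exp.1 (le_of_mul_le_mul_right hz (Real.rpow_pos_of_pos (h.fluid_pos hs) _))

theorem le_logDevFst_of_le (h : IsControlled α ρ c g ε κ β Δ d m N K x) {s : ℝ≥0}
    (hs : s ≤ K) {z : ℝ} (hz : Real.exp z * fluid N c s ^ α ≤ 1 + (x s 0 : ℝ)) :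
    z ≤ logDevFst α N c x s := by
  rw [h.one_add_eq_exp_logDevFst hs] at hz
  exact Real.exp_le_exp.1 (le_of_mul_le_mul_right hz (Real.rpow_pos_of_pos (h.fluid_pos hs) _))

/-- An excursion begins within `ε / 2 + ε / 16 = 9 ε / 16`; the remaining `7 ε / 16` up to `ε`
absorbs the fluctuation `m`. -/
theorem m_le_mul_fluid (h : IsControlled α ρ c g ε κ β Δ d m N K x) {s : ℝ≥0} (hs : s ≤ K)
    {z : ℝ} (hz : -1 ≤ z) :
    m ≤ (Real.exp z - Real.exp (z - 7 * ε / 16)) * fluid N c s ^ α := by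
  have hε := h.ε_pos
  have e1 : Real.exp (-(7 * ε / 16)) ≤ Real.exp (-(ε / 32)) := Real.exp_le_exp.2 (by linarith)
  have e2 : Real.exp (-1) ≤ Real.exp z := Real.exp_le_exp.2 hz
  have e3 : Real.exp (-(ε / 32)) ≤ 1 := Real.exp_le_one_iff.2 (by linarith)
  have e4 : Real.exp (z - 7 * ε / 16) = Real.exp z * Real.exp (-(7 * ε / 16)) := by
    rw [← Real.exp_add, sub_eq_add_neg]
  have e5 : (g * N) ^ α ≤ fluid N c s ^ α :=
    Real.rpow_le_rpow (mul_pos h.g_pos h.N_pos).le (h.le_fluid hs) h.α_pos.le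
  have e6 : 0 ≤ (g * N) ^ α := Real.rpow_nonneg (mul_pos h.g_pos h.N_pos).le _
  calc m ≤ (1 - Real.exp (-(ε / 32))) * (Real.exp (-1) * (g * N) ^ α) := h.m_le
    _ ≤ (1 - Real.exp (-(7 * ε / 16))) * (Real.exp z * fluid N c s ^ α) := by
        gcongr
        linarith
    _ = _ := by rw [e4]; ring

/-- Over the integers, the path stays close to the fluid path. -/
theorem abs_logDev_natCast_le (h : IsControlled α ρ c g ε κ β Δ d m N K x) (k : ℕ) (hk : k ≤ K) :
    |logDevFst α N c x k| ≤ ε ∧ |logDevSnd N c x k| ≤ ε / 16 := by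
  induction k using Nat.strong_induction_on with
  | _ k ih =>
  have hε := h.ε_pos
  have hε1 := h.ε_le
  have ha := h.α_pos
  have ha1 := h.α_lt_one
  rcases Nat.eq_zero_or_pos k with rfl | hk0
  · have := h.start_fst
    have := h.start_snd
    rw [Nat.cast_zero]
    constructor <;> linarith
  have hkK : (k : ℝ≥0) ≤ K := by exact_mod_cast hk
  have hunit : ∀ n : ℕ, n < k → ∀ s : ℝ≥0, n ≤ s → s ≤ (n + 1 : ℕ) →
      |logDevFst α N c x s - logDevFst α N c x n| ≤ ε / 16 ∧
        |logDevSnd N c x s - logDevSnd N c x n| ≤ ε / 16 := by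
    intro n hn s h1 h2
    obtain ⟨i1, i2⟩ := ih n hn (hn.le.trans hk)
    exact h.abs_logDev_sub_le (hn.trans_le hk) h1 h2 (by linarith) (by linarith)
  have hfloor : ∀ v : ℝ≥0, v < k → ⌊v⌋₊ < k ∧ (⌊v⌋₊ : ℝ≥0) ≤ v ∧ v ≤ (⌊v⌋₊ + 1 : ℕ) := by
    intro v hv
    refine ⟨(Nat.floor_lt zero_le).2 hv, Nat.floor_le zero_le, ?_⟩
    push_cast
    exact (Nat.lt_floor_add_one v).le
  -- Coarse bounds at all earlier real times. The bounds at `k` are then derived afresh from them,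
  -- so errors do not accumulate along the induction.
  have hrough : ∀ v : ℝ≥0, v < k → |logDevFst α N c x v| ≤ 1 ∧ |logDevSnd N c x v| ≤ ε / 8 := by
    intro v hv
    obtain ⟨f1, f2, f3⟩ := hfloor v hv
    obtain ⟨i1, i2⟩ := ih _ f1 (f1.le.trans hk)
    obtain ⟨u1, u2⟩ := hunit _ f1 v f2 f3
    rw [abs_le] at i1 i2 u1 u2
    constructor <;> rw [abs_le] <;> constructor <;> linarith
  have hvK : ∀ v : ℝ≥0, v < k → v ≤ K := fun v hv => hv.le.trans hkK
  have hmulY : ∀ v : ℝ≥0, v < k → |α * logDevSnd N c x v| ≤ ε / 8 := by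
    intro v hv
    rw [abs_mul, abs_of_pos ha]
    nlinarith [(hrough v hv).2, abs_nonneg (logDevSnd N c x v)]
  refine ⟨abs_le.2 ⟨?_, ?_⟩, ?_⟩
  -- On `[j + 1, k)` one has `X - α Y ≤ -ε/2 + ε/16 + ε/8 ≤ -ε/8`, so the queue loses at most `m`,
  -- while its target only decreases. The count starts at `j + 1` because `X` may still be inside
  -- the band just after `j`.
  · obtain ⟨j, hjk, hj, hlast⟩ := exists_last_lt (p := fun i : ℕ => -(ε / 2) ≤ logDevFst α N c x i)
      hk0 (by rw [Nat.cast_zero]; exact (abs_le.1 h.start_fst).1)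
    have hj1K : ((j + 1 : ℕ) : ℝ≥0) ≤ K := by exact_mod_cast (Nat.succ_le_of_lt hjk).trans hk
    have hdown := h.down_fst (j + 1) k hjk hk ?_
    · have hs := (hunit j hjk (j + 1 : ℕ) (by exact_mod_cast Nat.le_succ j) le_rfl).1
      have hj1 : -(9 * ε / 16) ≤ logDevFst α N c x (j + 1 : ℕ) := by
        linarith [(abs_le.1 hs).1]
      refine h.le_logDevFst_of_le hkK ?_
      have hm := h.m_le_mul_fluid hkK (z := -(9 * ε / 16)) (by linarith)
      have ee : -(9 * ε / 16) - 7 * ε / 16 = -ε := by ring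
      rw [ee] at hm
      have e1 := h.one_add_eq_exp_logDevFst hj1K
      have e2 : fluid N c k ^ α ≤ fluid N c (j + 1 : ℕ) ^ α :=
        Real.rpow_le_rpow (h.fluid_pos hkK).le
          (h.fluid_anti (by exact_mod_cast Nat.succ_le_of_lt hjk)) ha.le
      have e3 : Real.exp (-(9 * ε / 16)) * fluid N c k ^ α ≤
          Real.exp (logDevFst α N c x (j + 1 : ℕ)) * fluid N c (j + 1 : ℕ) ^ α :=
        mul_le_mul (Real.exp_le_exp.2 hj1) e2 (Real.rpow_nonneg (h.fluid_pos hkK).le _)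
          (Real.exp_pos _).le
      linarith
    · intro v hv1 hv2
      obtain ⟨f1, f2, f3⟩ := hfloor v hv2
      obtain ⟨r1, r2⟩ := hrough v hv2
      refine h.share_fst_le (hvK v hv2) r1 (by linarith) ?_
      have hjf : j < ⌊v⌋₊ := Nat.lt_of_succ_le (Nat.le_floor (by exact_mod_cast hv1))
      have := not_le.1 (hlast _ hjf f1)
      have := (abs_le.1 (hunit _ f1 v f2 f3).1).2
      have := (abs_le.1 (hmulY v hv2)).1
      linarith
  -- Here the falling target works against the bound, and the drift `d` is needed to keep up with
  -- it.
  · obtain ⟨j, hjk, hj, hlast⟩ := exists_last_lt (p := fun i : ℕ => logDevFst α N c x i ≤ ε / 2)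
      hk0 (by rw [Nat.cast_zero]; exact (abs_le.1 h.start_fst).2)
    have hj1K : ((j + 1 : ℕ) : ℝ≥0) ≤ K := by exact_mod_cast (Nat.succ_le_of_lt hjk).trans hk
    have hup := h.up_fst (j + 1) k hjk hk ?_
    · have hs := (hunit j hjk (j + 1 : ℕ) (by exact_mod_cast Nat.le_succ j) le_rfl).1
      have hj1 : logDevFst α N c x (j + 1 : ℕ) ≤ 9 * ε / 16 := by
        linarith [(abs_le.1 hs).2]
      refine h.logDevFst_le_of_le hkK ?_
      have hm := h.m_le_mul_fluid hkK (z := ε) (by linarith)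
      have ee : ε - 7 * ε / 16 = 9 * ε / 16 := by ring
      rw [ee] at hm
      have e1 := h.one_add_eq_exp_logDevFst hj1K
      have hlen : (0 : ℝ) ≤ (k : ℝ) - (j + 1 : ℕ) :=
        sub_nonneg.2 (by exact_mod_cast Nat.succ_le_of_lt hjk)
      have e2 : fluid N c (j + 1 : ℕ) ^ α - fluid N c k ^ α ≤
          (g * N) ^ (α - 1) * (c * ((k : ℝ) - (j + 1 : ℕ))) := by
        refine (rpow_sub_rpow_le ha1 (mul_pos h.g_pos h.N_pos) (h.le_fluid hkK)
          (h.fluid_anti (by exact_mod_cast Nat.succ_le_of_lt hjk))).trans_eq ?_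
        unfold fluid
        simp only [NNReal.coe_natCast]
        ring
      have e3 : Real.exp (logDevFst α N c x (j + 1 : ℕ)) * fluid N c (j + 1 : ℕ) ^ α ≤
          Real.exp (9 * ε / 16) * fluid N c (j + 1 : ℕ) ^ α :=
        mul_le_mul_of_nonneg_right (Real.exp_le_exp.2 hj1)
          (Real.rpow_nonneg (h.fluid_pos hj1K).le _)
      have e4 : Real.exp (9 * ε / 16) * (fluid N c (j + 1 : ℕ) ^ α - fluid N c k ^ α) ≤
          d * ((k : ℝ) - (j + 1 : ℕ)) := by
        have hnn : 0 ≤ (g * N) ^ (α - 1) * (c * ((k : ℝ) - (j + 1 : ℕ))) :=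
          mul_nonneg (Real.rpow_nonneg (mul_pos h.g_pos h.N_pos).le _)
            (mul_nonneg h.c_pos.le hlen)
        calc _ ≤ Real.exp (9 * ε / 16) * ((g * N) ^ (α - 1) * (c * ((k : ℝ) - (j + 1 : ℕ)))) :=
              mul_le_mul_of_nonneg_left e2 (Real.exp_pos _).le
          _ ≤ Real.exp 1 * ((g * N) ^ (α - 1) * (c * ((k : ℝ) - (j + 1 : ℕ)))) :=
              mul_le_mul_of_nonneg_right (Real.exp_le_exp.2 (by linarith)) hnn
          _ = (Real.exp 1 * (g * N) ^ (α - 1) * c) * ((k : ℝ) - (j + 1 : ℕ)) := by ring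
          _ ≤ _ := mul_le_mul_of_nonneg_right h.slope_le hlen
      linarith
    · intro v hv1 hv2
      obtain ⟨f1, f2, f3⟩ := hfloor v hv2
      obtain ⟨r1, r2⟩ := hrough v hv2
      refine h.share_fst_ge (hvK v hv2) r1 (by linarith) ?_
      have hjf : j < ⌊v⌋₊ := Nat.lt_of_succ_le (Nat.le_floor (by exact_mod_cast hv1))
      have := not_le.1 (hlast _ hjf f1)
      have := (abs_le.1 (hunit _ f1 v f2 f3).1).1
      have := (abs_le.1 (hmulY v hv2)).2
      linarith
  · have hsh : ∀ v : ℝ≥0, v < k → |share 1 (x v) - (1 - ρ)| ≤ κ := fun v hv =>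
      h.abs_share_snd_sub_le (hvK v hv) (hrough v hv).1 (by linarith [(hrough v hv).2])
    have hup := h.up_snd k hk fun v hv => by linarith [(abs_le.1 (hsh v hv)).1]
    have hdown := h.down_snd k hk fun v hv => by linarith [(abs_le.1 (hsh v hv)).2]
    refine abs_log_sub_log_le (h.fluid_pos hkK) ?_
    have hfl : fluid N c k = N - c * k := by simp [fluid]
    have hz : 0 ≤ 1 - Real.exp (-(ε / 16)) := by
      have : Real.exp (-(ε / 16)) ≤ 1 := Real.exp_le_one_iff.2 (by linarith)
      linarith
    have hb := h.β_le.trans (mul_le_mul_of_nonneg_left (h.le_fluid hkK) hz)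
    rw [abs_le]
    constructor <;> rw [hfl] at * <;> linarith

/-- The path stays close to the fluid path. -/
theorem abs_logDev_le (h : IsControlled α ρ c g ε κ β Δ d m N K x) {s : ℝ≥0} (hs : s < K) :
    |logDevFst α N c x s| ≤ 2 * ε ∧ |logDevSnd N c x s| ≤ 2 * ε := by
  have hε := h.ε_pos
  have hε1 := h.ε_le
  have hn : ⌊s⌋₊ < K := (Nat.floor_lt zero_le).2 hs
  obtain ⟨i1, i2⟩ := h.abs_logDev_natCast_le _ hn.le
  obtain ⟨u1, u2⟩ := h.abs_logDev_sub_le hn (Nat.floor_le zero_le)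
    (by push_cast; exact (Nat.lt_floor_add_one s).le) (by linarith) (by linarith)
  rw [abs_le] at i1 i2 u1 u2
  constructor <;> rw [abs_le] <;> constructor <;> linarith

end IsControlled

/-! ### Typical noise -/

/-- The counts of the point sets below the levels used for comparison have no large deviations
between integers up to `K`. -/
structure IsTypicalNoise (lam mu : Fin 2 → ℝ) (ρ κ Δ m : ℝ) (K : ℕ)
    (S : Fin 2 ⊕ Fin 2 → Set (ℝ≥0 × ℝ≥0)) : Prop where
  arrivals : ∀ i, ExcessBounded (S (.inl i)) (S (.inr i)) (lam i) (-1) (lam i) m K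
  departures : ∀ i, ExcessBounded (S (.inr i)) (S (.inl i)) (mu i) (-1) (mu i) m K
  -- The slack is half of the drift `mu 0 * Δ`; the other half remains as `d`.
  up_fst : ExcessBounded (S (.inl 0)) (S (.inr 0)) (lam 0) (mu 0 * (ρ + Δ)) (mu 0 * Δ / 2) m K
  down_fst : ExcessBounded (S (.inr 0)) (S (.inl 0)) (mu 0 * (ρ - Δ)) (lam 0) (mu 0 * Δ / 2) m K
  up_snd : ExcessBounded (S (.inl 1)) (S (.inr 1)) (lam 1) (mu 1 * (1 - ρ - κ)) (mu 1 * κ) m K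
  down_snd : ExcessBounded (S (.inr 1)) (S (.inl 1)) (mu 1 * (1 - ρ + κ)) (lam 1) (mu 1 * κ) m K

/-- With the level `-1` in second place, `ExcessBounded` bounds a single count. -/
theorem slab_eq_empty_of_neg {a : ℝ} (ha : a < 0) (s t : ℝ≥0) : slab (fun _ => a) s t = ∅ := by
  ext p
  simp only [slab, mem_ofPred_eq, mem_empty_iff_false, iff_false, not_and, not_le]
  intro _ _
  exact ha.trans_le p.1.coe_nonneg

theorem ExcessBounded.ncard_unit_le {S S' : Set (ℝ≥0 × ℝ≥0)} {a m : ℝ} {K : ℕ} (ha : 0 ≤ a)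
    (h : ExcessBounded S S' a (-1) a m K) {n : ℕ} (hn : n < K) :
    ((S ∩ slab (fun _ => a) n (n + 1 : ℕ)).ncard : ℝ) ≤ 2 * a + m := by
  have := h n (n + 1) (Nat.le_succ n) hn
  rw [slab_eq_empty_of_neg (a := -1) (by norm_num) (n : ℝ≥0) (n + 1 : ℕ), inter_empty, ncard_empty,
    max_eq_left ha, max_eq_right (by norm_num)] at this
  push_cast at this ⊢
  linarith

/-- A solution driven by typical noise is controlled. -/
theorem IsPathSolution.isControlled {lam mu : Fin 2 → ℝ} {S : Fin 2 ⊕ Fin 2 → Set (ℝ≥0 × ℝ≥0)}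
    {x : ℝ≥0 → Fin 2 → ℕ} (hx : IsPathSolution lam mu S x) (hlam : ∀ i, 0 < lam i)
    (hmu : ∀ i, 0 < mu i) {α c g ε κ Δ m m' N : ℝ} {K : ℕ}
    (hc : c = mu 1 * (1 - load lam mu 0 - load lam mu 1))
    (hs : IsTrackingScale α (load lam mu 0) c g ε κ ((2 * mu 1 / c + 1) * κ) Δ (mu 0 * Δ / 2) m N K)
    (hS : IsTypicalNoise lam mu (load lam mu 0) κ Δ m' K S)
    (hΔ0 : 0 ≤ Δ) (hΔ : Δ ≤ load lam mu 0) (hκ0 : 0 ≤ κ) (hκ : κ ≤ 1 - load lam mu 0)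
    (hm : ∀ i, 2 * lam i + 2 * mu i + 2 * m' ≤ m) (hm0 : 0 ≤ m') (hmκ : m' ≤ κ * N)
    (hfst : |(x 0 0 : ℝ) + 1 - N ^ α| ≤ (1 - Real.exp (-(ε / 2))) * N ^ α)
    (hN : 1 ≤ (1 - Real.exp (-(ε / 16))) * N) (hsnd : (x 0 1 : ℝ) = N) :
    IsControlled α (load lam mu 0) c g ε κ ((2 * mu 1 / c + 1) * κ) Δ (mu 0 * Δ / 2) m N K x := by
  have hρ0 : lam 0 = mu 0 * load lam mu 0 := by
    unfold load
    rw [mul_div_cancel₀ _ (hmu 0).ne']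
  have hρ1 : lam 1 = mu 1 * load lam mu 1 := by
    unfold load
    rw [mul_div_cancel₀ _ (hmu 1).ne']
  have hNp := hs.N_pos
  have hcp := hs.c_pos
  have hfl0 : fluid N c 0 = N := by simp [fluid]
  have hm'm : m' ≤ m := by
    have := hm 0
    linarith [hlam 0, hmu 0]
  have hmax : ∀ i, max (lam i) 0 = lam i := fun i => max_eq_left (hlam i).le
  have hkc : ∀ k : ℕ, k ≤ K → (k : ℝ) ≤ N / c := by
    intro k hk
    rw [le_div_iff₀ hcp]
    have h1 : (k : ℝ) ≤ K := by exact_mod_cast hk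
    have h2 := mul_le_mul_of_nonneg_left h1 hcp.le
    have h3 := mul_pos hs.g_pos hNp
    linarith [hs.horizon]
  -- The rate error is `mu 1 * κ` from the shifted level plus `mu 1 * κ` of noise slack, over a time
  -- at most `N / c`; the fluctuation adds `m' ≤ κ * N`.
  have herr : ∀ k : ℕ, k ≤ K → 2 * mu 1 * κ * k + m' ≤ (2 * mu 1 / c + 1) * κ * N := by
    intro k hk
    have h1 := mul_le_mul_of_nonneg_left (hkc k hk)
      (mul_nonneg (mul_nonneg zero_le_two (hmu 1).le) hκ0)
    have h2 : (2 * mu 1 / c + 1) * κ * N = 2 * mu 1 * κ * (N / c) + κ * N := by ring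
    linarith
  refine { hs with
    start_fst := ?_
    start_snd := ?_
    unit := ?_
    up_fst := ?_
    down_fst := ?_
    up_snd := ?_
    down_snd := ?_ }
  · rw [logDevFst, hfl0, ← Real.log_rpow hNp]
    refine abs_log_sub_log_le (Real.rpow_pos_of_pos hNp _) ?_
    rwa [add_comm (1 : ℝ)]
  · rw [logDevSnd, hfl0]
    refine abs_log_sub_log_le hNp ?_
    rw [hsnd, add_sub_cancel_right, abs_one]
    exact hN
  · intro i n hn s h1 h2
    refine (hx.abs_sub_le hmu i h1 h2).trans ?_
    have e1 := (hS.arrivals i).ncard_unit_le (hlam i).le hn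
    have e2 := (hS.departures i).ncard_unit_le (hmu i).le hn
    linarith [hm i]
  · intro j k hjk hk hv
    have h1 := hx.sub_le_of_le_share hmu 0 (s := j) (t := k) (by exact_mod_cast hjk) hv
    have h2 := hS.up_fst j k hjk hk
    rw [hmax, max_eq_left (mul_nonneg (hmu 0).le (by linarith)), hρ0] at h2
    rw [hρ0] at h1
    have h3 : (mu 0 * load lam mu 0 - mu 0 * (load lam mu 0 + Δ) + mu 0 * Δ / 2) * ((k : ℝ) - j) =
        -(mu 0 * Δ / 2 * ((k : ℝ) - j)) := by ring
    linarith
  · intro j k hjk hk hv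
    have h1 := hx.le_sub_of_share_le hmu 0 (s := j) (t := k) (by exact_mod_cast hjk) hv
    have h2 := hS.down_fst j k hjk hk
    rw [hmax, max_eq_left (mul_nonneg (hmu 0).le (by linarith)), hρ0] at h2
    rw [hρ0] at h1
    have h3 : (mu 0 * (load lam mu 0 - Δ) - mu 0 * load lam mu 0 + mu 0 * Δ / 2) * ((k : ℝ) - j) =
        -(mu 0 * Δ / 2 * ((k : ℝ) - j)) := by ring
    have h4 : 0 ≤ mu 0 * Δ / 2 * ((k : ℝ) - j) :=
      mul_nonneg (by have := hmu 0; positivity) (sub_nonneg.2 (by exact_mod_cast hjk))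
    linarith
  · intro k hk hv
    have h1 := hx.sub_le_of_le_share hmu 1 (s := 0) (t := k) zero_le (fun v _ h => hv v h)
    have h2 := hS.up_snd 0 k (Nat.zero_le k) hk
    rw [hmax, max_eq_left (mul_nonneg (hmu 1).le (by linarith)), hρ1] at h2
    rw [hρ1] at h1
    simp only [Nat.cast_zero, sub_zero] at h2
    have h3 : (mu 1 * load lam mu 1 - mu 1 * (1 - load lam mu 0 - κ) + mu 1 * κ) * (k : ℝ) =
        -(c * k) + 2 * mu 1 * κ * k := by rw [hc]; ring
    have h4 := herr k hk
    linarith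
  · intro k hk hv
    have h1 := hx.le_sub_of_share_le hmu 1 (s := 0) (t := k) zero_le (fun v _ h => hv v h)
    have h2 := hS.down_snd 0 k (Nat.zero_le k) hk
    rw [hmax, max_eq_left (mul_nonneg (hmu 1).le (by linarith)), hρ1] at h2
    rw [hρ1] at h1
    simp only [Nat.cast_zero, sub_zero] at h2
    have h3 : (mu 1 * (1 - load lam mu 0 + κ) - mu 1 * load lam mu 1 + mu 1 * κ) * (k : ℝ) =
        c * k + 2 * mu 1 * κ * k := by rw [hc]; ring
    have h4 := herr k hk
    linarith

/-- Noise is typical with high probability. -/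
theorem IsDrivingNoise.measure_not_isTypicalNoise_le {Ω : Type*} [mΩ : MeasurableSpace Ω]
    {F : Filtration ℝ≥0 mΩ} {pts : Fin 2 ⊕ Fin 2 → Ω → Set (ℝ≥0 × ℝ≥0)} {P : Measure Ω}
    [IsProbabilityMeasure P] (hn : IsDrivingNoise F pts P) {lam mu : Fin 2 → ℝ}
    (hlam : ∀ i, 0 < lam i) (hmu : ∀ i, 0 < mu i) {ρ κ Δ θ : ℝ} (hΔ0 : 0 ≤ Δ) (hΔ : Δ ≤ ρ)
    (hΔ1 : ρ + Δ ≤ 1) (hκ0 : 0 ≤ κ) (hκ : κ ≤ 1 - ρ) (hκ' : κ ≤ ρ)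
    (h0 : 0 ≤ θ) (h1 : θ ≤ 1)
    (hθ : θ * (lam 0 + mu 0) ≤ mu 0 * Δ / 2) (hθ' : θ * (lam 1 + mu 1) ≤ mu 1 * κ)
    (m : ℝ) (K : ℕ) :
    P {ω | ¬ IsTypicalNoise lam mu ρ κ Δ m K (fun q => pts q ω)} ≤
      8 * ENNReal.ofReal (((K : ℝ) + 1) ^ 2 * Real.exp (-(θ * m))) := by
  set b := ENNReal.ofReal (((K : ℝ) + 1) ^ 2 * Real.exp (-(θ * m)))
  have hmax : ∀ i, max (lam i) 0 = lam i := fun i => max_eq_left (hlam i).le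
  have hmax' : ∀ i w, 0 ≤ w → w ≤ 1 → max (mu i * w) 0 ≤ mu i := fun i w hw hw1 => by
    rw [max_eq_left (mul_nonneg (hmu i).le hw)]
    nlinarith [hmu i]
  have harr : ∀ i, P {ω | ¬ ExcessBounded (pts (.inl i) ω) (pts (.inr i) ω) (lam i) (-1) (lam i)
      m K} ≤ b := fun i => hn.measure_not_excessBounded_le (by simp) h0 h1
    (by
      rw [hmax, max_eq_right (by norm_num)]
      nlinarith [hlam i]) m K
  have hdep : ∀ i, P {ω | ¬ ExcessBounded (pts (.inr i) ω) (pts (.inl i) ω) (mu i) (-1) (mu i)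
      m K} ≤ b := fun i => hn.measure_not_excessBounded_le (by simp) h0 h1
    (by
      rw [max_eq_left (hmu i).le, max_eq_right (by norm_num)]
      nlinarith [hmu i]) m K
  have hup1 := hn.measure_not_excessBounded_le (q := .inl 0) (q' := .inr 0) (by simp) h0 h1
    (a := lam 0) (b := mu 0 * (ρ + Δ)) (e := mu 0 * Δ / 2)
    (by
      rw [hmax]
      have := hmax' 0 (ρ + Δ) (by linarith) hΔ1
      exact (mul_le_mul_of_nonneg_left (by linarith) h0).trans hθ) m K
  have hdn1 := hn.measure_not_excessBounded_le (q := .inr 0) (q' := .inl 0) (by simp) h0 h1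
    (a := mu 0 * (ρ - Δ)) (b := lam 0) (e := mu 0 * Δ / 2)
    (by
      rw [hmax]
      have := hmax' 0 (ρ - Δ) (by linarith) (by linarith)
      exact (mul_le_mul_of_nonneg_left (by linarith) h0).trans hθ) m K
  have hup2 := hn.measure_not_excessBounded_le (q := .inl 1) (q' := .inr 1) (by simp) h0 h1
    (a := lam 1) (b := mu 1 * (1 - ρ - κ)) (e := mu 1 * κ)
    (by
      rw [hmax]
      have := hmax' 1 (1 - ρ - κ) (by linarith) (by linarith)
      exact (mul_le_mul_of_nonneg_left (by linarith) h0).trans hθ') m K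
  have hdn2 := hn.measure_not_excessBounded_le (q := .inr 1) (q' := .inl 1) (by simp) h0 h1
    (a := mu 1 * (1 - ρ + κ)) (b := lam 1) (e := mu 1 * κ)
    (by
      rw [hmax]
      have := hmax' 1 (1 - ρ + κ) (by linarith) (by linarith)
      exact (mul_le_mul_of_nonneg_left (by linarith) h0).trans hθ') m K
  set A : Fin 2 → Set Ω := fun i =>
    {ω | ¬ ExcessBounded (pts (.inl i) ω) (pts (.inr i) ω) (lam i) (-1) (lam i) m K}
  set D : Fin 2 → Set Ω := fun i =>
    {ω | ¬ ExcessBounded (pts (.inr i) ω) (pts (.inl i) ω) (mu i) (-1) (mu i) m K}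
  set U₁ : Set Ω := {ω | ¬ ExcessBounded (pts (.inl 0) ω) (pts (.inr 0) ω) (lam 0)
    (mu 0 * (ρ + Δ)) (mu 0 * Δ / 2) m K}
  set D₁ : Set Ω := {ω | ¬ ExcessBounded (pts (.inr 0) ω) (pts (.inl 0) ω) (mu 0 * (ρ - Δ))
    (lam 0) (mu 0 * Δ / 2) m K}
  set U₂ : Set Ω := {ω | ¬ ExcessBounded (pts (.inl 1) ω) (pts (.inr 1) ω) (lam 1)
    (mu 1 * (1 - ρ - κ)) (mu 1 * κ) m K}
  set D₂ : Set Ω := {ω | ¬ ExcessBounded (pts (.inr 1) ω) (pts (.inl 1) ω) (mu 1 * (1 - ρ + κ))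
    (lam 1) (mu 1 * κ) m K}
  have hsub : {ω | ¬ IsTypicalNoise lam mu ρ κ Δ m K (fun q => pts q ω)} ⊆
      (((A 0 ∪ A 1) ∪ (D 0 ∪ D 1)) ∪ ((U₁ ∪ D₁) ∪ (U₂ ∪ D₂))) := by
    intro ω hω
    by_contra hcon
    simp only [mem_union, not_or] at hcon
    obtain ⟨⟨⟨a0, a1⟩, d0, d1⟩, ⟨u1, dd1⟩, u2, dd2⟩ := hcon
    refine hω ⟨fun i => ?_, fun i => ?_, not_not.1 u1, not_not.1 dd1, not_not.1 u2, not_not.1 dd2⟩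
    · fin_cases i
      · exact not_not.1 a0
      · exact not_not.1 a1
    · fin_cases i
      · exact not_not.1 d0
      · exact not_not.1 d1
  calc _ ≤ P (((A 0 ∪ A 1) ∪ (D 0 ∪ D 1)) ∪ ((U₁ ∪ D₁) ∪ (U₂ ∪ D₂))) := measure_mono hsub
    _ ≤ ((P (A 0) + P (A 1)) + (P (D 0) + P (D 1))) + ((P U₁ + P D₁) + (P U₂ + P D₂)) := by
        refine (measure_union_le _ _).trans (add_le_add ?_ ?_) <;>
          exact (measure_union_le _ _).trans (add_le_add (measure_union_le _ _)
            (measure_union_le _ _))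
    _ ≤ ((b + b) + (b + b)) + ((b + b) + (b + b)) := by
        have := harr 0
        have := harr 1
        have := hdep 0
        have := hdep 1
        gcongr
    _ = 8 * b := by ring

/-! ### Asymptotics of the constants -/

theorem tendsto_log_mul_rpow_neg {a : ℝ} (ha : 0 < a) :
    Tendsto (fun N : ℕ => Real.log N * (N : ℝ) ^ (-a)) atTop (𝓝 0) := by
  have h := (isLittleO_log_rpow_atTop ha).tendsto_div_nhds_zero.comp
    (tendsto_natCast_atTop_atTop (R := ℝ))
  refine h.congr fun N => ?_
  simp only [Function.comp]
  rw [Real.rpow_neg (Nat.cast_nonneg N), div_eq_mul_inv]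

theorem tendsto_natCast_rpow_atTop {a : ℝ} (ha : 0 < a) :
    Tendsto (fun N : ℕ => (N : ℝ) ^ a) atTop atTop :=
  (tendsto_rpow_atTop ha).comp tendsto_natCast_atTop_atTop

theorem tendsto_log_natCast_atTop : Tendsto (fun N : ℕ => Real.log N) atTop atTop :=
  Real.tendsto_log_atTop.comp tendsto_natCast_atTop_atTop

theorem tendsto_const_div_log_natCast (a : ℝ) :
    Tendsto (fun N : ℕ => a / Real.log N) atTop (𝓝 0) :=
  tendsto_const_nhds.div_atTop tendsto_log_natCast_atTop

/-- A stretched exponential over a logarithm beats a polynomial. -/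
theorem tendsto_sq_mul_exp_neg {a b q : ℝ} (ha : 0 < a) (hq : 0 < q) :
    Tendsto (fun N : ℕ => (b * N + 1) ^ 2 * Real.exp (-(q / Real.log N * (N : ℝ) ^ a)))
      atTop (𝓝 0) := by
  -- The exponential is then at most `N⁻³`, against a prefactor of order `N²`.
  have hev : ∀ᶠ N : ℕ in atTop, 3 * Real.log N ≤ q / Real.log N * (N : ℝ) ^ a := by
    have h := (tendsto_log_mul_rpow_neg (half_pos ha)).pow 2
    rw [zero_pow two_ne_zero] at h
    filter_upwards [h.eventually_le_const (div_pos hq three_pos), eventually_gt_atTop 1]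
      with N hN h1
    have hN1 : (1 : ℝ) < N := by exact_mod_cast h1
    have hlog : 0 < Real.log N := Real.log_pos hN1
    have hN0 : (0 : ℝ) < N := by linarith
    have e : (N : ℝ) ^ (-(a / 2)) * (N : ℝ) ^ (-(a / 2)) * (N : ℝ) ^ a = 1 := by
      rw [← Real.rpow_add hN0, ← Real.rpow_add hN0, show -(a / 2) + -(a / 2) + a = 0 by ring,
        Real.rpow_zero]
    rw [div_mul_eq_mul_div, le_div_iff₀ hlog]
    calc 3 * Real.log N * Real.log N
        = 3 * (Real.log N * (N : ℝ) ^ (-(a / 2))) ^ 2 * (N : ℝ) ^ a := by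
          linear_combination -(3 * Real.log N * Real.log N) * e
      _ ≤ 3 * (q / 3) * (N : ℝ) ^ a := by gcongr
      _ = q * (N : ℝ) ^ a := by ring
  have hlim : Tendsto (fun N : ℕ => ((|b| + 1) ^ 2) * ((N : ℝ) ^ (1 : ℝ))⁻¹) atTop (𝓝 0) := by
    simpa using (tendsto_natCast_rpow_atTop one_pos).inv_tendsto_atTop.const_mul ((|b| + 1) ^ 2)
  refine squeeze_zero' (Eventually.of_forall fun N => by positivity) ?_ hlim
  filter_upwards [hev, eventually_ge_atTop 1] with N hN h1
  have hN1 : (1 : ℝ) ≤ N := by exact_mod_cast h1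
  have hN0 : (0 : ℝ) < N := by linarith
  have e1 : Real.exp (-(q / Real.log N * (N : ℝ) ^ a)) ≤ ((N : ℝ) ^ 3)⁻¹ := by
    refine (Real.exp_le_exp.2 (neg_le_neg hN)).trans_eq ?_
    rw [Real.exp_neg, mul_comm, Real.exp_mul, Real.exp_log hN0]
    norm_cast
  have e2 : (b * N + 1) ^ 2 ≤ ((|b| + 1) * N) ^ 2 := by
    refine sq_le_sq' ?_ ?_ <;> nlinarith [neg_abs_le b, le_abs_self b, abs_nonneg b]
  calc _ ≤ ((|b| + 1) * N) ^ 2 * ((N : ℝ) ^ 3)⁻¹ := by gcongr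
    _ = _ := by
        rw [Real.rpow_one]
        field_simp

theorem one_sub_exp_neg_pos {z : ℝ} (hz : 0 < z) : 0 < 1 - Real.exp (-z) :=
  sub_pos.2 (Real.exp_lt_one_iff.2 (by linarith))

theorem eventually_const_le_mul_natCast (a : ℝ) {b : ℝ} (hb : 0 < b) :
    ∀ᶠ N : ℕ in atTop, a ≤ b * N :=
  (tendsto_natCast_atTop_atTop.const_mul_atTop hb).eventually_ge_atTop a

/-- Gap and drift are of order `1 / log N`, fluctuations of order `N ^ α`. The drift condition
amounts to `N ^ (α - 1) * log N → 0`, which is where `α < 1` is decisive. -/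
theorem eventually_isTrackingScale {α ρ c g ε κ β D d κ₀ T : ℝ} (hα : 0 < α) (hα1 : α < 1)
    (hρ1 : ρ < 1) (hρ : α * (1 - ρ) = ρ) (hc : 0 < c) (hg : 0 < g) (hg1 : g ≤ 1)
    (hgT : g = 1 - c * T) (hT : 0 ≤ T) (hε : 0 < ε) (hε1 : ε ≤ 1 / 2) (hκ : 0 < κ)
    (hβ : β ≤ (1 - Real.exp (-(ε / 16))) * g / 2) (hD : D = (1 - ρ) * (ε / 24)) (hd : 0 < d)
    (hκ₀ : 3 * κ₀ ≤ (1 - Real.exp (-(ε / 32))) * Real.exp (-1) * g) :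
    ∀ᶠ N : ℕ in atTop, IsTrackingScale α ρ c g ε κ β (D / Real.log N) (d / Real.log N)
      (3 * (κ₀ * (N : ℝ) ^ α)) N ⌊T * N⌋₊ := by
  have hz := one_sub_exp_neg_pos (z := ε / 32) (by linarith)
  have hz' := one_sub_exp_neg_pos (z := ε / 16) (by linarith)
  have hslope : ∀ᶠ N : ℕ in atTop, Real.exp 1 * g ^ (α - 1) * c *
      (Real.log N * (N : ℝ) ^ (-(1 - α))) ≤ d := by
    have h := (tendsto_log_mul_rpow_neg (sub_pos.2 hα1)).const_mul (Real.exp 1 * g ^ (α - 1) * c)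
    rw [mul_zero] at h
    exact h.eventually_le_const hd
  filter_upwards [eventually_gt_atTop 1,
    tendsto_log_natCast_atTop.eventually_ge_atTop (4 - 4 * Real.log g),
    (tendsto_const_div_log_natCast 4).eventually_le_const hκ,
    eventually_const_le_mul_natCast c (mul_pos hz hg),
    eventually_const_le_mul_natCast 1 (half_pos (mul_pos hz' hg)), hslope]
    with N h1 hl hl' hcN hβN hsl
  have hN1 : (1 : ℝ) < N := by exact_mod_cast h1
  have hN0 : (0 : ℝ) < N := by linarith
  have hlog : 0 < Real.log N := Real.log_pos hN1
  have hNα0 : 0 < (N : ℝ) ^ α := Real.rpow_pos_of_pos hN0 _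
  have hNα : (N : ℝ) ^ α ≤ N :=
    (Real.rpow_le_rpow_of_exponent_le hN1.le hα1.le).trans_eq (Real.rpow_one _)
  have hgα : g ≤ g ^ α :=
    (Real.rpow_one g).symm.le.trans (Real.rpow_le_rpow_of_exponent_ge hg hg1 hα1.le)
  have hm : 3 * (κ₀ * (N : ℝ) ^ α) ≤
      (1 - Real.exp (-(ε / 32))) * (Real.exp (-1) * (g * (N : ℝ) ^ α)) := by
    have := mul_le_mul_of_nonneg_right hκ₀ hNα0.le
    linarith
  exact
    { α_pos := hα
      α_lt_one := hα1
      ρ_lt_one := hρ1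
      ρ_eq := hρ
      c_pos := hc
      g_pos := hg
      ε_pos := hε
      ε_le := hε1
      N_pos := hN0
      horizon := by
        have := mul_le_mul_of_nonneg_left (Nat.floor_le (mul_nonneg hT hN0.le)) hc.le
        rw [hgT]
        linarith
      log_large := hl
      log_large' := hl'
      gap_le := by
        rw [hD]
        refine le_of_eq ?_
        field_simp
        ring
      c_le := by linarith
      m_le := by
        refine hm.trans ?_
        rw [Real.mul_rpow hg.le hN0.le]
        gcongr
      m_le' := by
        refine hm.trans ?_
        gcongr
      slope_le := by
        rw [le_div_iff₀ hlog, Real.mul_rpow hg.le hN0.le]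
        rw [neg_sub] at hsl
        linarith
      β_le := by
        have := mul_le_mul_of_nonneg_right hβ hN0.le
        linarith }

/-! ### Uniform convergence in probability -/

/-- Closeness of the logarithmic deviations to zero gives closeness on the linear scale. -/
theorem abs_div_sub_le_of_log {n M r a : ℝ} (hM : 0 < M) (hn : 0 ≤ n) (hr : 0 < r) (hr1 : r ≤ 1)
    (ha1 : a ≤ 1) (h : |Real.log (1 + n) - Real.log (M * r)| ≤ a) :
    |n / M - r| ≤ 2 * a + 1 / M := by
  set X := Real.log (1 + n) - Real.log (M * r) with hX
  have he : 1 + n = Real.exp X * (M * r) := by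
    rw [hX, Real.exp_sub, Real.exp_log (by positivity), Real.exp_log (by positivity),
      div_mul_cancel₀ _ (by positivity)]
  have h1 := Real.abs_exp_sub_one_le (h.trans ha1)
  have e : n / M - r = (Real.exp X - 1) * r - 1 / M := by
    have : n = Real.exp X * (M * r) - 1 := by linarith
    rw [this]
    field_simp
    ring
  rw [e]
  refine (abs_sub _ _).trans ?_
  rw [abs_mul, abs_of_pos hr, abs_of_pos (one_div_pos.2 hM)]
  have : |Real.exp X - 1| * r ≤ 2 * a := by
    nlinarith [abs_nonneg (Real.exp X - 1)]
  linarith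

theorem fluid_toNNReal {N c t : ℝ} (hN : 0 ≤ N) (ht : 0 ≤ t) :
    fluid N c (N * t).toNNReal = N * (1 - c * t) := by
  rw [fluid, Real.coe_toNNReal _ (mul_nonneg hN ht)]
  ring

theorem IsControlled.abs_scaled_sub_le {α ρ c g ε κ β Δ d m : ℝ} {N K : ℕ}
    {x : ℝ≥0 → Fin 2 → ℕ} (h : IsControlled α ρ c g ε κ β Δ d m N K x) {t : ℝ} (ht : 0 ≤ t)
    (htK : N * t < K) :
    |(x (N * t).toNNReal 0 : ℝ) / (N : ℝ) ^ α - (1 - c * t) ^ α| ≤ 4 * ε + 1 / (N : ℝ) ^ α ∧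
      |(x (N * t).toNNReal 1 : ℝ) / N - (1 - c * t)| ≤ 4 * ε + 1 / N := by
  have hN : (0 : ℝ) < N := h.N_pos
  have hs : (N * t).toNNReal < (K : ℝ≥0) := by
    rw [Real.toNNReal_lt_iff_lt_coe (mul_nonneg hN.le ht)]
    simpa using htK
  obtain ⟨h1, h2⟩ := h.abs_logDev_le hs
  have hfl := fluid_toNNReal (c := c) hN.le ht
  have hpos := h.fluid_pos hs.le
  rw [hfl] at hpos
  have hr : 0 < 1 - c * t := pos_of_mul_pos_right hpos hN.le
  have hr1 : 1 - c * t ≤ 1 := by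
    have := mul_nonneg h.c_pos.le ht
    linarith
  have hε := h.ε_le
  unfold logDevFst at h1
  unfold logDevSnd at h2
  rw [hfl] at h1 h2
  constructor
  · rw [← Real.log_rpow hpos, Real.mul_rpow hN.le hr.le] at h1
    have := abs_div_sub_le_of_log (Real.rpow_pos_of_pos hN α) (Nat.cast_nonneg _)
      (Real.rpow_pos_of_pos hr α) (Real.rpow_le_one hr.le hr1 h.α_pos.le) (by linarith) h1
    linarith
  · have := abs_div_sub_le_of_log hN (Nat.cast_nonneg _) hr hr1 (by linarith) h2
    linarith

/-! ### Convergence in distribution to a constant -/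

/-- Neighbourhoods in `E` need not be measurable, but only those of the form `|Φ y - Φ x| < δ / 2`
matter, and these are measurable since `Φ` is. -/
theorem convergesInDistribution_dirac {E : Type*} [TopologicalSpace E] [MeasurableSpace E]
    {Ω : ℕ → Type*} [∀ N, MeasurableSpace (Ω N)] {P : ∀ N, Measure (Ω N)}
    [∀ N, IsProbabilityMeasure (P N)] {X : ∀ N, Ω N → E} (hX : ∀ N, Measurable (X N)) (x : E)
    (h : ∀ U ∈ 𝓝 x, Tendsto (fun N => P N {ω | X N ω ∉ U}) atTop (𝓝 0)) :
    ConvergesInDistribution P X (Measure.dirac x) := by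
  refine ⟨hX, fun Φ hc hm ⟨C, hC⟩ => ?_⟩
  rw [integral_dirac' _ _ hm.stronglyMeasurable, Metric.tendsto_atTop']
  intro δ hδ
  have hC0 : 0 ≤ C := (abs_nonneg _).trans (hC x)
  set U : Set E := {y | |Φ y - Φ x| < δ / 2} with hU
  have hUx : U ∈ 𝓝 x := by
    have : Tendsto (fun y => |Φ y - Φ x|) (𝓝 x) (𝓝 0) := by
      have := ((hc.tendsto x).sub_const (Φ x)).abs
      simpa using this
    exact this.eventually_lt_const (half_pos hδ)
  have hlim : Tendsto (fun N => 2 * C * (P N).real {ω | X N ω ∉ U}) atTop (𝓝 0) := by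
    have := (ENNReal.tendsto_toReal ENNReal.zero_ne_top).comp (h U hUx)
    simpa [measureReal_def] using this.const_mul (2 * C)
  obtain ⟨N₀, hN₀⟩ := eventually_atTop.1 (hlim.eventually_lt_const (half_pos hδ))
  refine ⟨N₀, fun N hN => ?_⟩
  have h_int : Integrable (fun ω => Φ (X N ω)) (P N) :=
    Integrable.of_bound (hm.comp (hX N)).aestronglyMeasurable C
      (Eventually.of_forall fun ω => hC _)
  have hS : MeasurableSet {ω | X N ω ∉ U} := by
    have : MeasurableSet U :=
      measurableSet_lt ((hm.sub_const _).norm) measurable_const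
    exact (hX N) this.compl
  have hsub : ∫ ω, Φ (X N ω) ∂(P N) - Φ x = ∫ ω, (Φ (X N ω) - Φ x) ∂(P N) := by
    rw [integral_sub h_int (integrable_const _)]
    simp
  rw [Real.dist_eq, hsub]
  calc |∫ ω, (Φ (X N ω) - Φ x) ∂(P N)| ≤ ∫ ω, |Φ (X N ω) - Φ x| ∂(P N) :=
        abs_integral_le_integral_abs
    _ ≤ ∫ ω, (δ / 2 + {ω | X N ω ∉ U}.indicator (fun _ => 2 * C) ω) ∂(P N) := by
        refine integral_mono (h_int.sub (integrable_const _)).abs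
          ((integrable_const _).add ((integrable_const _).indicator hS)) fun ω => ?_
        by_cases hω : X N ω ∈ U
        · rw [indicator_of_notMem (by simpa using hω), add_zero]
          exact (show |Φ (X N ω) - Φ x| < δ / 2 from hω).le
        · rw [indicator_of_mem (by exact hω)]
          have := abs_sub (Φ (X N ω)) (Φ x)
          linarith [hC x, hC (X N ω)]
    _ = δ / 2 + 2 * C * (P N).real {ω | X N ω ∉ U} := by
        rw [integral_add (integrable_const _) ((integrable_const _).indicator hS),
          integral_indicator_const _ hS]
        simp [mul_comm]
    _ < δ := by
        have := hN₀ N (le_of_lt hN)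
        linarith

/-- Neighbourhoods of a path contain all paths that are uniformly close to it on some `[0, T]`. -/
theorem exists_uniform_subset_of_mem_nhds {a : ℝ} (ha : 0 < a) (f : CadlagPath a)
    {U : Set (CadlagPath a)} (hU : U ∈ 𝓝 f) :
    ∃ T, 0 ≤ T ∧ T < a ∧ ∃ η > 0, ∀ f' : CadlagPath a,
      (∀ t : Ico (0 : ℝ) a, (t : ℝ) ≤ T →
        |(f'.toFun t).1 - (f.toFun t).1| ≤ η ∧ |(f'.toFun t).2 - (f.toFun t).2| ≤ η) → f' ∈ U := by
  rw [nhds_induced, mem_comap] at hU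
  obtain ⟨V, hV, hVU⟩ := hU
  have hne : {K : Set (Ico (0 : ℝ) a) | IsCompact K}.Nonempty := ⟨∅, isCompact_empty⟩
  have hdir : DirectedOn (· ⊆ ·) {K : Set (Ico (0 : ℝ) a) | IsCompact K} :=
    fun K hK K' hK' => ⟨K ∪ K', IsCompact.union hK hK', subset_union_left, subset_union_right⟩
  rw [(UniformOnFun.hasBasis_nhds_of_basis _ _ _ _ hne hdir Metric.uniformity_basis_dist).mem_iff]
    at hV
  obtain ⟨⟨K, η⟩, ⟨hK, hη⟩, hsub⟩ := hV
  -- A nonempty compact subset of `[0, a)` has a largest element, which is less than `a`.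
  obtain ⟨T, hT0, hTa, hKT⟩ : ∃ T, 0 ≤ T ∧ T < a ∧ ∀ t ∈ K, (t : ℝ) ≤ T := by
    rcases K.eq_empty_or_nonempty with rfl | hKne
    · exact ⟨0, le_rfl, ha, fun t ht => absurd ht (notMem_empty t)⟩
    · obtain ⟨t, ht, hmax⟩ := IsCompact.exists_isMaxOn hK hKne continuous_subtype_val.continuousOn
      exact ⟨t, t.2.1, t.2.2, fun s hs => hmax hs⟩
  refine ⟨T, hT0, hTa, η / 2, half_pos hη, fun f' hf' => hVU (hsub ?_)⟩
  intro t ht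
  obtain ⟨h1, h2⟩ := hf' t (hKT t ht)
  change dist (f'.toFun t) (f.toFun t) < η
  rw [Prod.dist_eq, Real.dist_eq, Real.dist_eq]
  have hη' : 0 < η := hη
  exact max_lt (by linarith) (by linarith)

theorem alphaStar_mul {lam mu : Fin 2 → ℝ} (h : load lam mu 0 < 1) :
    alphaStar lam mu * (1 - load lam mu 0) = load lam mu 0 :=
  div_mul_cancel₀ _ (ne_of_gt (sub_pos.2 h))

/-- Uniform convergence in probability on compact time intervals. -/
theorem tendsto_measure_not_uniformly_close (lam mu : Fin 2 → ℝ) (hlam : ∀ i, 0 < lam i)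
    (hmu : ∀ i, 0 < mu i) (hρ₁ : load lam mu 0 < 1 / 2)
    (hρ : load lam mu 0 + load lam mu 1 < 1)
    {Ω : ℕ → Type*} [mΩ : ∀ N, MeasurableSpace (Ω N)] (P : ∀ N, Measure (Ω N))
    [∀ N, IsProbabilityMeasure (P N)] (F : ∀ N, Filtration ℝ≥0 (mΩ N))
    (pts : ∀ N, Fin 2 ⊕ Fin 2 → Ω N → Set (ℝ≥0 × ℝ≥0)) (L : ∀ N, ℝ≥0 → Ω N → Fin 2 → ℕ)
    (hL : ∀ N, IsSolution lam mu (F N) (pts N) (P N) (L N))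
    (hL₂ : ∀ N, ∀ᵐ ω ∂(P N), L N 0 ω 1 = N)
    (hL₁ : ∀ ε : ℝ, 0 < ε → Tendsto
      (fun N : ℕ => P N {ω | ε < |(L N 0 ω 0 : ℝ) / (N : ℝ) ^ alphaStar lam mu - 1|})
      atTop (𝓝 0))
    {T η : ℝ} (hT0 : 0 ≤ T) (hT : T < tZero lam mu) (hη : 0 < η) :
    Tendsto (fun N : ℕ => P N {ω | ¬ ∀ t : ℝ, 0 ≤ t → t ≤ T →
      |(L N (N * t).toNNReal ω 0 : ℝ) / (N : ℝ) ^ alphaStar lam mu -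
        gam lam mu t ^ alphaStar lam mu| ≤ η ∧
      |(L N (N * t).toNNReal ω 1 : ℝ) / N - gam lam mu t| ≤ η}) atTop (𝓝 0) := by
  set ρ := load lam mu 0 with hρdef
  set α := alphaStar lam mu with hαdef
  set c := mu 1 * (1 - load lam mu 0 - load lam mu 1) with hcdef
  have hρ0 : 0 < ρ := div_pos (hlam 0) (hmu 0)
  have hρ1 : ρ < 1 := by linarith
  have hαρ : α * (1 - ρ) = ρ := alphaStar_mul hρ1
  have hα : 0 < α := div_pos hρ0 (by linarith)
  have hα1 : α < 1 := by
    rw [hαdef, alphaStar, div_lt_one (by linarith)]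
    linarith
  have hc : 0 < c := mul_pos (hmu 1) (by linarith)
  have hgam : ∀ t, gam lam mu t = 1 - c * t := fun t => by
    unfold gam
    rw [hcdef]
    ring
  -- The margin `T' - T` ensures `N * t < ⌊T' * N⌋₊` for `t ≤ T`, and the fluid at `T'` is still a
  -- positive fraction `g` of `N`.
  obtain ⟨T', hTT', hcT'⟩ : ∃ T', T < T' ∧ c * T' < 1 := by
    obtain ⟨T', h1, h2⟩ := exists_between hT
    refine ⟨T', h1, ?_⟩
    unfold tZero at h2
    rw [lt_div_iff₀ hc] at h2
    linarith
  have hT'0 : 0 ≤ T' := hT0.trans hTT'.le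
  set g := 1 - c * T' with hgdef
  have hg : 0 < g := by linarith
  have hg1 : g ≤ 1 := by linarith [mul_nonneg hc.le hT'0]
  -- The final error is `4 * ε + 1 / N ^ α`; each term gets half of `η`.
  set ε := min (1 / 2) (η / 8) with hεdef
  have hε : 0 < ε := lt_min (by norm_num) (by linarith)
  have hε1 : ε ≤ 1 / 2 := min_le_left _ _
  have hεη : ε ≤ η / 8 := min_le_right _ _
  have hz16 := one_sub_exp_neg_pos (z := ε / 16) (by linarith)
  have hz32 := one_sub_exp_neg_pos (z := ε / 32) (by linarith)
  have hz2 := one_sub_exp_neg_pos (z := ε / 2) (by linarith)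
  have hb : 0 < 2 * mu 1 / c + 1 := by
    have := hmu 1
    positivity
  set κ := min ρ ((1 - Real.exp (-(ε / 16))) * g / 2 / (2 * mu 1 / c + 1)) with hκdef
  have hκ : 0 < κ := lt_min hρ0 (by positivity)
  have hκρ : κ ≤ ρ := min_le_left _ _
  have hβ : (2 * mu 1 / c + 1) * κ ≤ (1 - Real.exp (-(ε / 16))) * g / 2 := by
    have := min_le_right ρ ((1 - Real.exp (-(ε / 16))) * g / 2 / (2 * mu 1 / c + 1))
    rwa [le_div_iff₀ hb, mul_comm] at this
  set κ₀ := min κ ((1 - Real.exp (-(ε / 32))) * Real.exp (-1) * g / 3) with hκ₀def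
  have hκ₀ : 0 < κ₀ := lt_min hκ (by positivity)
  have hκ₀κ : κ₀ ≤ κ := min_le_left _ _
  have hκ₀' : 3 * κ₀ ≤ (1 - Real.exp (-(ε / 32))) * Real.exp (-1) * g := by
    have := min_le_right κ ((1 - Real.exp (-(ε / 32))) * Real.exp (-1) * g / 3)
    linarith
  set D := (1 - ρ) * (ε / 24) with hDdef
  have hD : 0 < D := mul_pos (by linarith) (by linarith)
  have hm0 := hmu 0
  have hl0 := hlam 0
  -- Chosen so that the Chernoff parameter `θ = q / log N` gives equality in `θ * (lam 0 + mu 0) ≤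
  -- mu 0 * Δ / 2`.
  set q := mu 0 * D / 2 / (lam 0 + mu 0) with hqdef
  have hq : 0 < q := by positivity
  -- Half of the allowed initial error; the other half absorbs the `1` in `1 + x`.
  set ξ := (1 - Real.exp (-(ε / 2))) / 2 with hξdef
  have hξ : 0 < ξ := half_pos hz2
  set bound : ℕ → ℝ := fun N =>
    (T' * N + 1) ^ 2 * Real.exp (-(q * κ₀ / Real.log N * (N : ℝ) ^ α)) with hbound
  have hbound0 : Tendsto bound atTop (𝓝 0) := tendsto_sq_mul_exp_neg hα (mul_pos hq hκ₀)
  have hlim : Tendsto (fun N : ℕ => 8 * ENNReal.ofReal (bound N) +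
      P N {ω | ξ < |(L N 0 ω 0 : ℝ) / (N : ℝ) ^ α - 1|}) atTop (𝓝 0) := by
    have h1 := ENNReal.Tendsto.const_mul (a := 8) (ENNReal.tendsto_ofReal hbound0)
      (Or.inr (by simp))
    simpa using h1.add (hL₁ ξ hξ)
  refine tendsto_of_tendsto_of_tendsto_of_le_of_le' tendsto_const_nhds hlim
    (Eventually.of_forall fun N => zero_le) ?_
  have hNα := tendsto_natCast_rpow_atTop hα
  have hev_arr : ∀ᶠ N : ℕ in atTop, ∀ i, 2 * lam i + 2 * mu i ≤ κ₀ * (N : ℝ) ^ α :=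
    eventually_all.2 fun i => (hNα.const_mul_atTop hκ₀).eventually_ge_atTop _
  filter_upwards [eventually_isTrackingScale (d := mu 0 * D / 2) (κ := κ) hα hα1 hρ1 hαρ hc hg hg1
      hgdef hT'0 hε hε1 hκ hβ hDdef (by positivity) hκ₀',
    eventually_gt_atTop 1, hev_arr,
    (tendsto_const_div_log_natCast D).eventually_le_const hρ0,
    (tendsto_const_div_log_natCast q).eventually_le_const one_pos,
    (tendsto_const_div_log_natCast q).eventually_le_const
      (div_pos (mul_pos (hmu 1) hκ) (add_pos (hlam 1) (hmu 1))),
    eventually_const_le_mul_natCast 1 hz16,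
    (hNα.const_mul_atTop hξ).eventually_ge_atTop 1,
    eventually_const_le_mul_natCast 1 (sub_pos.2 hTT'),
    (hNα.const_mul_atTop (half_pos hη)).eventually_ge_atTop 1]
    with N hscale hN1 harr hΔρ hθ1 hθκ hN16 hNξ hNT hNη
  have hN1' : (1 : ℝ) < N := by exact_mod_cast hN1
  have hN0 : (0 : ℝ) < N := by linarith
  have hlog : 0 < Real.log N := Real.log_pos hN1'
  have hNα0 : 0 < (N : ℝ) ^ α := Real.rpow_pos_of_pos hN0 _
  have hNαN : (N : ℝ) ^ α ≤ N :=
    (Real.rpow_le_rpow_of_exponent_le hN1'.le hα1.le).trans_eq (Real.rpow_one _)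
  have hΔ0 : 0 ≤ D / Real.log N := by positivity
  have hd : mu 0 * D / 2 / Real.log N = mu 0 * (D / Real.log N) / 2 := by ring
  rw [hd] at hscale
  have htyp := (hL N).noise.measure_not_isTypicalNoise_le hlam hmu (ρ := ρ) (κ := κ)
    (Δ := D / Real.log N) (θ := q / Real.log N) hΔ0 hΔρ (by linarith) hκ.le (by linarith) hκρ
    (by positivity) hθ1
    (by
      refine le_of_eq ?_
      rw [hqdef]
      field_simp)
    (by rwa [le_div_iff₀ (add_pos (hlam 1) (hmu 1))] at hθκ)
    (κ₀ * (N : ℝ) ^ α) ⌊T' * N⌋₊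
  have htyp' : P N {ω | ¬ IsTypicalNoise lam mu ρ κ (D / Real.log N) (κ₀ * (N : ℝ) ^ α)
      ⌊T' * N⌋₊ (fun p => pts N p ω)} ≤ 8 * ENNReal.ofReal (bound N) := by
    refine htyp.trans ?_
    refine mul_le_mul' le_rfl (ENNReal.ofReal_le_ofReal ?_)
    simp only [hbound]
    have e : q / Real.log N * (κ₀ * (N : ℝ) ^ α) = q * κ₀ / Real.log N * (N : ℝ) ^ α := by ring
    rw [e]
    gcongr
    exact Nat.floor_le (mul_nonneg hT'0 hN0.le)
  have hae : ∀ᵐ ω ∂(P N), IsPathSolution lam mu (fun p => pts N p ω) (fun t => L N t ω) ∧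
      L N 0 ω 1 = N := by
    filter_upwards [(hL N).noise.ae_finite, (hL N).equation, hL₂ N] with ω h1 h2 h3
    exact ⟨⟨(hL N).cadlag ω, h1, h2⟩, h3⟩
  rw [ae_iff] at hae
  -- The bad event is covered by atypical noise, a bad start of the first queue, and a null set.
  refine (measure_mono (t := ({ω | ¬ IsTypicalNoise lam mu ρ κ (D / Real.log N)
      (κ₀ * (N : ℝ) ^ α) ⌊T' * N⌋₊ (fun p => pts N p ω)} ∪
        {ω | ξ < |(L N 0 ω 0 : ℝ) / (N : ℝ) ^ α - 1|}) ∪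
        {ω | ¬ (IsPathSolution lam mu (fun p => pts N p ω) (fun t => L N t ω) ∧
          L N 0 ω 1 = N)}) ?_).trans ?_
  · intro ω hω
    by_contra hcon
    simp only [mem_union, mem_ofPred_eq, not_or, not_not, not_lt] at hcon
    obtain ⟨⟨htn, hin⟩, hps, hsnd⟩ := hcon
    refine hω ?_
    have hctl := hps.isControlled hlam hmu hcdef hscale htn hΔ0 hΔρ hκ.le (by linarith)
      (fun i => by linarith [harr i]) (by positivity)
      (mul_le_mul hκ₀κ hNαN hNα0.le hκ.le) ?_ hN16 (by simp [hsnd])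
    · intro t ht0 htT
      have htK : (N : ℝ) * t < (⌊T' * N⌋₊ : ℕ) := by
        have h1 := Nat.lt_floor_add_one (T' * N)
        have h2 := mul_le_mul_of_nonneg_left htT hN0.le
        linarith
      obtain ⟨h1, h2⟩ := hctl.abs_scaled_sub_le ht0 htK
      rw [hgam]
      have e1 : 1 / (N : ℝ) ^ α ≤ η / 2 := by
        rw [div_le_iff₀ hNα0]
        exact hNη
      have e2 : 1 / (N : ℝ) ≤ 1 / (N : ℝ) ^ α := one_div_le_one_div_of_le hNα0 hNαN
      exact ⟨by linarith, by linarith⟩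
    · have e : (L N 0 ω 0 : ℝ) + 1 - (N : ℝ) ^ α =
          ((L N 0 ω 0 : ℝ) / (N : ℝ) ^ α - 1) * (N : ℝ) ^ α + 1 := by
        field_simp
        ring
      rw [e]
      refine (abs_add_le _ _).trans ?_
      rw [abs_mul, abs_of_pos hNα0, abs_one]
      have h1 := mul_le_mul_of_nonneg_right hin hNα0.le
      have h2 : (1 - Real.exp (-(ε / 2))) = 2 * ξ := by rw [hξdef]; ring
      rw [h2]
      linarith
  · refine (measure_union_le _ _).trans ?_
    rw [hae, add_zero]
    exact (measure_union_le _ _).trans (add_le_add htyp' le_rfl)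

theorem measurable_scaledPath {Ω : Type*} [MeasurableSpace Ω] (a α : ℝ) (N : ℕ)
    {L : ℝ≥0 → Ω → Fin 2 → ℕ} (hm : ∀ t, Measurable (L t))
    (hc : ∀ ω, IsCadlag fun t => L t ω) :
    Measurable fun ω => scaledPath a α N (fun t => L t ω) (hc ω) := by
  refine measurable_comap_iff.2 (measurable_pi_iff.2 fun t => ?_)
  have h : ∀ i, Measurable fun ω => (L (N * (t : ℝ)).toNNReal ω i : ℝ) := fun i =>
    measurable_from_top.comp ((measurable_pi_apply i).comp (hm _))
  exact ((h 0).div_const _).prodMk ((h 1).div_const _)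

end

end LogSharing

theorem theorem3 (lam mu : Fin 2 → ℝ) (hlam : ∀ i, 0 < lam i) (hmu : ∀ i, 0 < mu i)
    (hρ₁ : LogSharing.load lam mu 0 < 1 / 2)
    (hρ : LogSharing.load lam mu 0 + LogSharing.load lam mu 1 < 1)
    {Ω : ℕ → Type*} [mΩ : ∀ N, MeasurableSpace (Ω N)] (P : ∀ N, Measure (Ω N))
    [∀ N, IsProbabilityMeasure (P N)]
    (F : ∀ N, Filtration ℝ≥0 (mΩ N))
    (pts : ∀ N, Fin 2 ⊕ Fin 2 → Ω N → Set (ℝ≥0 × ℝ≥0))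
    (L : ∀ N, ℝ≥0 → Ω N → Fin 2 → ℕ)
    (hL : ∀ N, LogSharing.IsSolution lam mu (F N) (pts N) (P N) (L N))
    (hL₂ : ∀ N, ∀ᵐ ω ∂(P N), L N 0 ω 1 = N)
    (hL₁ : ∀ ε : ℝ, 0 < ε → Tendsto
      (fun N : ℕ => P N {ω | ε < |(L N 0 ω 0 : ℝ) / (N : ℝ) ^ LogSharing.alphaStar lam mu - 1|})
      atTop (𝓝 0)) :
    LogSharing.ConvergesInDistribution P
      (fun N ω => LogSharing.scaledPath (LogSharing.tZero lam mu) (LogSharing.alphaStar lam mu) N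
        (fun t => L N t ω) ((hL N).cadlag ω))
      (Measure.dirac (LogSharing.limitPath lam mu)) := by
  have ht₀ : 0 < LogSharing.tZero lam mu :=
    one_div_pos.2 (mul_pos (hmu 1) (by linarith))
  refine LogSharing.convergesInDistribution_dirac
    (fun N => LogSharing.measurable_scaledPath _ _ N
      (fun t => ((hL N).adapted t).mono ((F N).le t) le_rfl) (hL N).cadlag) _ fun U hU => ?_
  obtain ⟨T, hT0, hT, η, hη, hclose⟩ := LogSharing.exists_uniform_subset_of_mem_nhds ht₀ _ hU
  refine tendsto_of_tendsto_of_tendsto_of_le_of_le tendsto_const_nhds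
    (LogSharing.tendsto_measure_not_uniformly_close lam mu hlam hmu hρ₁ hρ P F pts L hL hL₂ hL₁
      hT0 hT hη) (fun N => zero_le) fun N => measure_mono fun ω hω hall => hω ?_
  exact hclose _ fun t ht => hall t t.2.1 ht
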